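/- **Setting.** The points of $\mathbf{S}^2\times\mathbf{R}$ are the pairs $(P,p)$ with $P\in\mathbf{S}^2\subset\mathbf{R}^3$, $p\in\mathbf{R}$; the geodesic distance is $d((P,p),(Q,q))=\sqrt{\angle(P,Q)^2+(p-q)^2}$, where $\angle$ is the spherical distance, and volume is the product of the surface measure of $\mathbf{S}^2$ and Lebesgue measure. Let $\mathbf g_1,\mathbf g_2,\mathbf g_3$ be the reflections of $\mathbf{S}^2$ in the sides $A_2A_3$, $A_1A_3$, $A_1A_2$ of the spherical triangle with vertices $A_1=(1,0,0)$, $A_2=(0,1,0)$, $A_3=(0,0,1)$ (angles $\frac\pi2,\frac\pi2,\frac\pi2$). For $\tau>0$ the space group $\Gamma_\tau=\mathbf{4q.I.2}$ with $q=2$ is generated by $\mathbf g_1$ and $\mathbf g_2$, acting trivially on the fibre $\mathbf{R}$, and by the glide reflection $\tau\mathbf g_3$, that is $\mathbf g_3$ combined with the fibre translation by $\tau$; its fibre translations are generated by the translation $2\tau$. For a point $K$ with trivial stabilizer in $\Gamma_\tau$ and $R>0$, the balls $B_{K^{\mathbf g}}(R)=\{P: d(K^{\mathbf g},P)\le R\}$,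 $\mathbf g\in\Gamma_\tau$, form a *simply transitive ball packing* if balls with different centres have no common interior points. Its density is $$\delta=\frac{\mathrm{Vol}\big(\bigcup_{\mathbf g\in\Gamma_\tau}B_{K^{\mathbf g}}(R)\cap\mathcal D(K)\big)}{\mathrm{Vol}(\mathcal D(K))},\qquad \mathcal D(K)=\{P: d(K,P)\le d(K^{\mathbf g},P)\ \text{for all }\mathbf g\in\Gamma_\tau\}.$$ **Theorem 2.7.** (i) There is exactly one triple consisting of $\tau>0$, $R$, and a point $K$ with fibre coordinate $0$ in the interior of the triangle $A_1A_2A_3$, such that $$d(K,K^{\mathbf g_1})=d(K,K^{\mathbf g_2})=d(K,K^{\tau\mathbf g_3})=2R\le d(K,K^{\tau\mathbf g_3\tau\mathbf g_3})=d(K,K^{2\tau})\le 4R,\qquad d(K,K^{2\tau})=2R .$$ Denote it by $(\tau_1,R_1,K_1)$. Then $K_1=(\cos\phi_1\cos\theta_1,\ \sin\phi_1\cos\theta_1,\ \sin\theta_1)$ with $$\phi_1=\tfrac{\pi}{4},\quad \theta_1\approx 0.55737781,\quad R_1\approx 0.64360446,\quad \mathrm{Vol}(B_{K_1}(R_1))\approx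 1.08624788 .$$ The balls of radius $R_1$ around the $\Gamma_{\tau_1}$-orbit of $K_1$ form a simply transitive ball packing $\mathcal B_\Gamma(R_1,K_1)$ of density $\delta_1\approx 0.53722971$, and $R_1$ is the greatest radius for which the balls around this orbit form a packing. (Each $\approx$ means an error of less than $10^{-8}$.) (ii) $\mathcal B_\Gamma(R_1,K_1)$ is the densest simply transitive ball packing belonging to **4q.I.2** ($q=2$): for every $\tau>0$, every point $K=(P,p)$ with trivial stabilizer in $\Gamma_\tau$ and every $R$ for which the balls of radius $R$ around the $\Gamma_\tau$-orbit of $K$ form a packing, the density $\delta$ of this packing satisfies $\delta\le\delta_1$. Equality holds if and only if $\tau=\tau_1$, $R=R_1$ and the coordinates of $P\in\mathbf{S}^2$ agree up to signs with those of $K_1$. -/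

import Mathlib

open Real Set MeasureTheory

noncomputable section

namespace S2R

/-- Euclidean three-space, which contains the unit sphere `S²`. -/
abbrev E3 : Type := EuclideanSpace ℝ (Fin 3)

/-- The unit sphere `S²`. -/
abbrev Sphere2 : Type := Metric.sphere (0 : E3) 1

/-- The points `(P, p)` of the space `S² × R`. -/
abbrev Space : Type := Sphere2 × ℝ

/-- The geodesic distance of the Riemannian product `S² × R`: the distance on the factor `S²` is
the spherical (angular) distance, and a shortest geodesic with angular displacement `a` and fibre
displacement `t` has arc length `√(a² + t²)`. -/
def gdist (K P : Space) : ℝ :=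
  √((InnerProductGeometry.angle (K.1 : E3) (P.1 : E3)) ^ 2 + (K.2 - P.2) ^ 2)

/-- The (closed) geodesic ball of centre `K` and radius `R`. -/
def gball (K : Space) (R : ℝ) : Set Space := {P | gdist K P ≤ R}

/-- The open geodesic ball. For `R > 0` it is the interior of `gball K R`: moving a point along
its fibre, away from the level of `K`, increases its distance from `K`. -/
def openGball (K : Space) (R : ℝ) : Set Space := {P | gdist K P < R}

/-- The Riemannian volume of `S² × R`: the product of the surface measure of the unit sphere
(of total mass `4π`) and of the Lebesgue measure of the line. -/
def vol : Measure Space := ((volume : Measure E3).toSphere).prod (volume : Measure ℝ)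

/-- The isometry group `Isom(S²) × Isom(R)` of `S² × R`; the isometries of `S²` are the
restrictions of the linear isometries of `E3`. -/
abbrev Isom : Type := (E3 ≃ₗᵢ[ℝ] E3) × (ℝ ≃ᵢ ℝ)

/-- The image of a point under an isometry. -/
def act (g : Isom) (P : Space) : Space :=
  (⟨g.1 (P.1 : E3), by
    have h : ‖(P.1 : E3)‖ = 1 := mem_sphere_zero_iff_norm.mp P.1.2
    rw [mem_sphere_zero_iff_norm, LinearIsometryEquiv.norm_map, h]⟩, g.2 P.2)

/-- The reflection of `E3` (and of `S²`) in the coordinate plane orthogonal to the `i`-th axis. -/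
def mirror (i : Fin 3) : E3 ≃ₗᵢ[ℝ] E3 :=
  (ℝ ∙ (EuclideanSpace.single i (1 : ℝ) : E3))ᗮ.reflection

/-- The translation of `S² × R` by `τ` along the fibres. -/
def fibreTranslation (τ : ℝ) : Isom := (1, IsometryEquiv.addRight τ)

/-- The generator `g₁`: the reflection in the side `A₂A₃` of the spherical triangle with
`A₁ = (1,0,0)`, `A₂ = (0,1,0)`, `A₃ = (0,0,1)`, without translation part. -/
def g₁ : Isom := (mirror 0, 1)

/-- The generator `g₂`: the reflection in the side `A₁A₃`, without translation part. -/
def g₂ : Isom := (mirror 1, 1)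

/-- The generator `τg₃`: the reflection in the side `A₁A₂` followed by the translation by `τ`
along the fibres. -/
def τg₃ (τ : ℝ) : Isom := (mirror 2, IsometryEquiv.addRight τ)

/-- The space group **4q.I.2** for `q = 2`: its point group is generated by the reflections in the
sides of the spherical triangle with angles `π/2, π/2, π/2`, with translation parts `0, 0, τ`
of the three generators. Its lattice of fibre translations is generated by `2τ`. -/
def spaceGroup (τ : ℝ) : Subgroup Isom := Subgroup.closure {g₁, g₂, τg₃ τ}

/-- `Γ` acts simply transitively on the orbit of `K`: the stabilizer of `K` is trivial. -/
def IsSimplyTransitive (Γ : Subgroup Isom) (K : Space) : Prop :=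
  ∀ g ∈ Γ, act g K = K → g = 1

/-- The Dirichlet–Voronoi cell to `Γ` around the kernel point `K`. -/
def dvCell (Γ : Subgroup Isom) (K : Space) : Set Space :=
  {P | ∀ g ∈ Γ, gdist K P ≤ gdist (act g K) P}

/-- The union of the balls of radius `R` around the points of the orbit of `K`. -/
def ballUnion (Γ : Subgroup Isom) (K : Space) (R : ℝ) : Set Space :=
  ⋃ g ∈ Γ, gball (act g K) R

/-- The balls of radius `R` around the points of the orbit of `K` form a packing: balls with
distinct centres have no common interior point. -/
def IsBallPacking (Γ : Subgroup Isom) (K : Space) (R : ℝ) : Prop :=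
  0 < R ∧ ∀ g ∈ Γ, ∀ h ∈ Γ, act g K ≠ act h K →
    Disjoint (openGball (act g K) R) (openGball (act h K) R)

/-- The density of the ball arrangement with respect to the Dirichlet–Voronoi cell. -/
def density (Γ : Subgroup Isom) (K : Space) (R : ℝ) : ℝ :=
  vol.real (ballUnion Γ K R ∩ dvCell Γ K) / vol.real (dvCell Γ K)

/-- The point of `S²` with longitude `φ` and latitude `θ`. -/
def geoPoint (φ θ : ℝ) : Sphere2 :=
  ⟨!₂[cos φ * cos θ, sin φ * cos θ, sin θ], by
    rw [mem_sphere_zero_iff_norm, EuclideanSpace.norm_eq, Real.sqrt_eq_one]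
    simp only [Fin.sum_univ_three, Real.norm_eq_abs, sq_abs]
    simp
    nlinarith [sin_sq_add_cos_sq φ, sin_sq_add_cos_sq θ]⟩

/-- The interior of the spherical triangle `A₁A₂A₃`. -/
def triangleInterior : Set Sphere2 := {P | ∀ i : Fin 3, 0 < (P : E3) i}

/-- The requirements on the arrangement `B_Γ(R₁, K₁)`: the ball `B_K(R)` touches its images under
`g₁`, `g₂`, `τg₃` and under the translation by `2τ`. -/
structure IsFirstArrangement (τ : ℝ) (K : Space) (R : ℝ) : Prop where
  touch_g₁ : gdist K (act g₁ K) = 2 * R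
  touch_g₂ : gdist K (act g₂ K) = 2 * R
  touch_τg₃ : gdist K (act (τg₃ τ) K) = 2 * R
  lower : 2 * R ≤ gdist K (act (τg₃ τ * τg₃ τ) K)
  middle : gdist K (act (τg₃ τ * τg₃ τ) K) = gdist K (act (fibreTranslation (2 * τ)) K)
  upper : gdist K (act (fibreTranslation (2 * τ)) K) ≤ 4 * R
  touch_translation : gdist K (act (fibreTranslation (2 * τ)) K) = 2 * R

end S2R

end

open S2R

noncomputable section

namespace S2R

open scoped Pointwise ENNReal
open InnerProductGeometry (angle)

/-! Every element of `spaceGroup τ` multiplies the coordinates by signs `a`, `b`, `(-1) ^ k` and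
moves the fibre by `k * τ`. Let `K` lie over `(x, y, z)`; a trivial stabilizer means `x, y ≠ 0`. Two
consequences carry the proof. The balls of radius `R > 0` form a packing exactly when `R ≤ arcsin
|x|`, `R ≤ arcsin |y|`, `4R² ≤ 4 arcsin² |z| + τ²` and `R ≤ τ` (`Admissible`). The cell of `K` lies
over a quarter sphere, and its fibres over a point and over the mirror image in `z = 0` have total
length `2τ`. So its volume is `πτ`, wherever `K` is (`vol_dvCell`). The ball lies in the cell and
has volume `2πR I(R)`, where `I` is `ballProfile`; hence the density is `2R I(R) / τ`
(`density_eq`).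

Equality in all four inequalities means `τ = R`, `|x| = |y| = sin R`, `|z| = sin (√3/2 R)`. Unit
norm then reads `touchEq R = 1`, which has a single root `R₁` because `touchEq` increases; the
density there is `2 I(R₁)`.

For `R ≤ R₁`, the bound `τ ≥ R` and monotonicity of `I` give density at most `2 I(R) ≤ 2 I(R₁)`. For
`R > R₁`, the quotient `I(R) / R²` does not increase, so it suffices that `R³ < τ R₁²`. Here the
mirrors push `K` towards the equator: `z² ≤ 1 - 2 sin² R = cos 2R`, and the glide inequality forces
`τ` to be large (`Admissible.mul_ballProfile_lt`). Equality of densities forces `τ = R = R₁`, and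
then the lower bounds on `|x|, |y|, |z|` use up the unit norm, so they are attained.

The numerical values come from alternating Taylor polynomials of the cosine, integrated term by
term. -/

/-! ### Mirrors, and the surface measure of quarter spheres -/

theorem mirror_apply (i j : Fin 3) (v : E3) : mirror i v j = if j = i then -v j else v j := by
  unfold mirror
  rw [Submodule.reflection_orthogonal_apply, Submodule.reflection_singleton_apply]
  by_cases h : j = i
  · subst h; simp [EuclideanSpace.inner_single_left]; ring
  · simp [EuclideanSpace.inner_single_left, h]

/-- The surface measure of the unit sphere. -/
abbrev surf : Measure Sphere2 := (volume : Measure E3).toSphere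

/-- The action of a linear isometry on the unit sphere. -/
def sphereMap (L : E3 ≃ₗᵢ[ℝ] E3) (P : Sphere2) : Sphere2 :=
  ⟨L P, by rw [mem_sphere_zero_iff_norm, LinearIsometryEquiv.norm_map,
    mem_sphere_zero_iff_norm.mp P.2]⟩

@[simp] theorem coe_sphereMap (L : E3 ≃ₗᵢ[ℝ] E3) (P : Sphere2) :
    ((sphereMap L P : Sphere2) : E3) = L P := rfl

theorem continuous_sphereMap (L : E3 ≃ₗᵢ[ℝ] E3) : Continuous (sphereMap L) :=
  (L.continuous.comp continuous_subtype_val).subtype_mk _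

/-- `toSphere` measures a set by the volume of the punctured cone over it. Taking the radius to be
`‖v‖` makes membership easy to transport along isometries. -/
theorem mem_cone_iff (s : Set Sphere2) (v : E3) :
    v ∈ Ioo (0 : ℝ) 1 • ((↑) '' s : Set E3) ↔
      ∃ P ∈ s, 0 < ‖v‖ ∧ ‖v‖ < 1 ∧ v = ‖v‖ • (P : E3) := by
  constructor
  · rintro ⟨r, hr, _, ⟨P, hP, rfl⟩, rfl⟩
    have hn : ‖(P : E3)‖ = 1 := mem_sphere_zero_iff_norm.mp P.2
    have : ‖r • (P : E3)‖ = r := by rw [norm_smul, hn, Real.norm_of_nonneg hr.1.le, mul_one]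
    refine ⟨P, hP, ?_⟩
    simp only [this]
    exact ⟨hr.1, hr.2, trivial⟩
  · rintro ⟨P, hP, h0, h1, hv⟩
    exact ⟨‖v‖, ⟨h0, h1⟩, P, ⟨P, hP, rfl⟩, hv.symm⟩

theorem measurePreserving_sphereMap (L : E3 ≃ₗᵢ[ℝ] E3) :
    MeasurePreserving (sphereMap L) surf surf := by
  refine ⟨(continuous_sphereMap L).measurable, ?_⟩
  ext s hs
  rw [Measure.map_apply (continuous_sphereMap L).measurable hs,
    Measure.toSphere_apply' _ ((continuous_sphereMap L).measurable hs), Measure.toSphere_apply' _ hs]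
  conv_rhs => rw [← L.measurePreserving.measure_preimage_emb L.toHomeomorph.measurableEmbedding]
  congr 2
  ext v
  rw [mem_preimage, mem_cone_iff, mem_cone_iff]
  constructor
  · rintro ⟨P, hP, h0, h1, hv⟩
    refine ⟨sphereMap L P, hP, ?_⟩
    rw [L.norm_map]
    refine ⟨h0, h1, ?_⟩
    conv_lhs => rw [hv]
    rw [map_smul, coe_sphereMap]
  · rintro ⟨P, hP, h0, h1, hv⟩
    rw [L.norm_map] at h0 h1 hv
    refine ⟨sphereMap L.symm P, ?_, h0, h1, ?_⟩
    · have : sphereMap L (sphereMap L.symm P) = P := by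
        ext1; simp
      rwa [mem_preimage, this]
    · apply L.injective
      rw [hv, map_smul, coe_sphereMap]
      simp

theorem surf_univ : surf univ = ENNReal.ofReal (4 * π) := by
  rw [Measure.toSphere_apply_univ, EuclideanSpace.volume_ball_fin_three, finrank_euclideanSpace_fin]
  rw [ENNReal.ofReal_one, one_pow, one_mul, ← ENNReal.ofReal_natCast, ← ENNReal.ofReal_mul (by positivity)]
  congr 1; push_cast; ring

theorem surf_coord_eq_zero (i : Fin 3) : surf {P : Sphere2 | (P : E3) i = 0} = 0 := by
  have hm : MeasurableSet {P : Sphere2 | (P : E3) i = 0} := by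
    apply measurableSet_eq_fun _ measurable_const
    exact (by fun_prop : Continuous fun P : Sphere2 => (P : E3) i).measurable
  rw [Measure.toSphere_apply' _ hm]
  have hker : volume ((LinearMap.ker (EuclideanSpace.proj i : E3 →L[ℝ] ℝ).toLinearMap :
      Submodule ℝ E3) : Set E3) = 0 := by
    apply Measure.addHaar_submodule
    intro h
    have : EuclideanSpace.single i (1:ℝ) ∈ LinearMap.ker
      (EuclideanSpace.proj i : E3 →L[ℝ] ℝ).toLinearMap := by rw [h]; trivial
    simp at this
  rw [measure_mono_null _ hker, mul_zero]
  intro v hv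
  obtain ⟨P, hP, -, -, hv⟩ := (mem_cone_iff _ _).1 hv
  have hP' : (P : E3) i = 0 := hP
  rw [SetLike.mem_coe, LinearMap.mem_ker]
  show v i = 0
  rw [hv]
  simp [hP']

/-- The quarter of the sphere on which the first two coordinates have the signs of `a` and `b`. -/
def quarter (a b : ℝ) : Set Sphere2 := {P | 0 ≤ a * (P : E3) 0 ∧ 0 ≤ b * (P : E3) 1}

theorem measurableSet_quarter (a b : ℝ) : MeasurableSet (quarter a b) := by
  apply IsClosed.measurableSet
  have h : ∀ (c : ℝ) (i : Fin 3), Continuous fun P : Sphere2 => c * (P : E3) i := fun c i => by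
    fun_prop
  exact (isClosed_le continuous_const (h a 0)).inter (isClosed_le continuous_const (h b 1))

theorem surf_quarter_neg_left (a b : ℝ) : surf (quarter (-a) b) = surf (quarter a b) := by
  rw [← (measurePreserving_sphereMap (mirror 0)).measure_preimage
    (measurableSet_quarter a b).nullMeasurableSet]
  congr 1
  ext P
  simp [quarter, mirror_apply]

theorem surf_quarter_neg_right (a b : ℝ) : surf (quarter a (-b)) = surf (quarter a b) := by
  rw [← (measurePreserving_sphereMap (mirror 1)).measure_preimage
    (measurableSet_quarter a b).nullMeasurableSet]
  congr 1
  ext P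
  simp [quarter, mirror_apply]

/-- The four sign choices give mirror images of one another, which cover the sphere and overlap only
in great circles, a null set. -/
theorem surf_quarter {a b : ℝ} (ha : a ≠ 0) (hb : b ≠ 0) : surf (quarter a b) = ENNReal.ofReal π := by
  have h1 : ∀ c d : ℝ, surf (quarter c d) = ∫⁻ P, (quarter c d).indicator 1 P ∂surf := fun c d => by
    rw [lintegral_indicator_one (measurableSet_quarter c d)]
  have hmeas : ∀ c d : ℝ, Measurable ((quarter c d).indicator (1 : Sphere2 → ℝ≥0∞)) := fun c d =>
    measurable_one.indicator (measurableSet_quarter c d)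
  have hsum : surf (quarter a b) + surf (quarter (-a) b) + surf (quarter a (-b)) +
      surf (quarter (-a) (-b)) = ENNReal.ofReal (4 * π) := by
    rw [← surf_univ, ← lintegral_indicator_one (MeasurableSet.univ), h1, h1, h1, h1,
      ← lintegral_add_right _ (hmeas _ _), ← lintegral_add_right _ (hmeas _ _),
      ← lintegral_add_right _ (hmeas _ _)]
    apply lintegral_congr_ae
    have hx := measure_eq_zero_iff_ae_notMem.1 (surf_coord_eq_zero 0)
    have hy := measure_eq_zero_iff_ae_notMem.1 (surf_coord_eq_zero 1)
    filter_upwards [hx, hy] with P hPx hPy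
    have hPx' : a * (P : E3) 0 ≠ 0 := mul_ne_zero ha hPx
    have hPy' : b * (P : E3) 1 ≠ 0 := mul_ne_zero hb hPy
    rcases lt_or_gt_of_ne hPx' with h | h <;> rcases lt_or_gt_of_ne hPy' with h' | h' <;>
    simp [indicator, quarter, h.le, h'.le, h.not_ge, h'.not_ge]
  rw [surf_quarter_neg_left, surf_quarter_neg_right, surf_quarter_neg_left,
    ENNReal.ofReal_mul (by norm_num), surf_quarter_neg_right] at hsum
  have h4 : (4 : ℝ≥0∞) * surf (quarter a b) = 4 * ENNReal.ofReal π := by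
    rw [show (4 : ℝ≥0∞) * surf (quarter a b) = surf (quarter a b) + surf (quarter a b) +
      surf (quarter a b) + surf (quarter a b) by ring, hsum]
    norm_num
  exact (ENNReal.mul_right_inj (by norm_num) (by norm_num)).1 h4

/-! ### Area of a spherical cap -/

/-- The splitting of `E3` into its first coordinate and the plane of the other two. -/
def splitFirst (v : E3) : ℝ × EuclideanSpace ℝ (Fin 2) := (v 0, WithLp.toLp 2 fun i => v i.succ)

theorem measurePreserving_splitFirst : MeasurePreserving splitFirst := by
  have h1 := PiLp.volume_preserving_ofLp (Fin 3)
  have h2 := volume_preserving_piFinSuccAbove (fun _ : Fin 3 => ℝ) 0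
  have h3 := (MeasurePreserving.id (volume : Measure ℝ)).prod (PiLp.volume_preserving_toLp (Fin 2))
  exact (h3.comp h2).comp h1

/-- The open sector of the unit ball over the spherical cap around the first axis. -/
def sector (c : ℝ) : Set (ℝ × EuclideanSpace ℝ (Fin 2)) :=
  {q | 0 < q.1 ^ 2 + ‖q.2‖ ^ 2 ∧ q.1 ^ 2 + ‖q.2‖ ^ 2 < 1 ∧ 0 ≤ q.1 ∧
    c ^ 2 * (q.1 ^ 2 + ‖q.2‖ ^ 2) ≤ q.1 ^ 2}

theorem measurableSet_sector (c : ℝ) : MeasurableSet (sector c) := by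
  have h : Continuous fun q : ℝ × EuclideanSpace ℝ (Fin 2) => q.1 ^ 2 + ‖q.2‖ ^ 2 := by fun_prop
  refine (isOpen_lt continuous_const h).measurableSet.inter
    ((isOpen_lt h continuous_const).measurableSet.inter
    ((isClosed_le continuous_const continuous_fst).measurableSet.inter
    (isClosed_le (continuous_const.mul h) (continuous_fst.pow 2)).measurableSet))

theorem volume_disc_le (a : ℝ) (ha : 0 ≤ a) :
    volume {w : EuclideanSpace ℝ (Fin 2) | ‖w‖ ^ 2 ≤ a} = ENNReal.ofReal (π * a) := by
  have : {w : EuclideanSpace ℝ (Fin 2) | ‖w‖ ^ 2 ≤ a} = Metric.closedBall 0 (√a) := by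
    ext w
    rw [mem_ofPred_eq, mem_closedBall_zero_iff, Real.le_sqrt (norm_nonneg w) ha]
  rw [this, EuclideanSpace.volume_closedBall_fin_two, ← ENNReal.ofReal_pow (sqrt_nonneg a),
    ← ENNReal.ofReal_mul (by positivity), sq_sqrt ha, mul_comm]

theorem volume_disc_lt (a : ℝ) (ha : 0 ≤ a) :
    volume {w : EuclideanSpace ℝ (Fin 2) | ‖w‖ ^ 2 < a} = ENNReal.ofReal (π * a) := by
  have : {w : EuclideanSpace ℝ (Fin 2) | ‖w‖ ^ 2 < a} = Metric.ball 0 (√a) := by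
    ext w
    rw [mem_ofPred_eq, mem_ball_zero_iff, Real.lt_sqrt (norm_nonneg w)]
  rw [this, EuclideanSpace.volume_ball_fin_two, ← ENNReal.ofReal_pow (sqrt_nonneg a),
    ← ENNReal.ofReal_mul (by positivity), sq_sqrt ha, mul_comm]

/-- Each slice is a disc: up to height `c` it is bounded by the cone, above `c` by the unit sphere.
-/
theorem volume_sector_slice {c : ℝ} (hc : 0 < c) (hc1 : c ≤ 1) (z : ℝ) :
    volume (Prod.mk z ⁻¹' sector c) =
      (Ioc 0 c).indicator (fun z => ENNReal.ofReal (π * ((1 - c ^ 2) / c ^ 2 * z ^ 2))) z +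
      (Ioc c 1).indicator (fun z => ENNReal.ofReal (π * (1 - z ^ 2))) z := by
  have hc2 : 0 < c ^ 2 := by positivity
  have hc21 : c ^ 2 ≤ 1 := pow_le_one₀ hc.le hc1
  rcases le_or_gt z 0 with hz | hz
  · have he : Prod.mk z ⁻¹' sector c = ∅ := by
      ext w
      simp only [sector, mem_preimage, mem_ofPred_eq, mem_empty_iff_false, iff_false]
      rintro ⟨h1, -, h2, h3⟩
      obtain rfl := le_antisymm hz h2
      have := mul_pos hc2 h1
      linarith
    rw [he, measure_empty, indicator_of_notMem (fun h => hz.not_gt h.1),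
      indicator_of_notMem (fun h => (hz.trans hc.le).not_gt h.1), add_zero]
  rcases le_or_gt z c with hzc | hzc
  · rw [indicator_of_mem (show z ∈ Ioc 0 c from ⟨hz, hzc⟩),
      indicator_of_notMem (fun h => hzc.not_gt h.1), add_zero]
    have hz2 : z ^ 2 ≤ c ^ 2 := by gcongr
    have hnn : 0 ≤ (1 - c ^ 2) / c ^ 2 * z ^ 2 :=
      mul_nonneg (div_nonneg (by linarith) hc2.le) (sq_nonneg z)
    rcases hzc.lt_or_eq with hlt | rfl
    · rw [← volume_disc_le _ hnn]
      congr 1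
      ext w
      simp only [sector, mem_preimage, mem_ofPred_eq]
      have hlt2 : z ^ 2 < c ^ 2 := by gcongr
      rw [div_mul_eq_mul_div, le_div_iff₀ hc2]
      constructor
      · rintro ⟨-, -, -, h⟩
        linarith
      · intro h
        refine ⟨by positivity, ?_, hz.le, by linarith⟩
        by_contra! h'
        nlinarith
    -- At height `z = c` the two radii coincide and the strict bound of the open unit ball decides,
    -- so the disc is open.
    · rw [← volume_disc_lt _ hnn]
      congr 1
      ext w
      simp only [sector, mem_preimage, mem_ofPred_eq]
      rw [div_mul_cancel₀ _ hc2.ne']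
      constructor
      · rintro ⟨-, h, -, -⟩
        linarith
      · intro h
        refine ⟨by positivity, by linarith, hz.le, ?_⟩
        nlinarith
  · rw [indicator_of_notMem (fun h => hzc.not_ge h.2), zero_add]
    rcases le_or_gt z 1 with hz1 | hz1
    · rw [indicator_of_mem (show z ∈ Ioc c 1 from ⟨hzc, hz1⟩)]
      have hz2 : z ^ 2 ≤ 1 := pow_le_one₀ hz.le hz1
      rw [← volume_disc_lt _ (by linarith)]
      congr 1
      ext w
      simp only [sector, mem_preimage, mem_ofPred_eq]
      have hlt2 : c ^ 2 < z ^ 2 := by gcongr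
      constructor
      · rintro ⟨-, h, -, -⟩
        linarith
      · intro h
        refine ⟨by positivity, by linarith, hz.le, ?_⟩
        nlinarith
    · rw [indicator_of_notMem (fun h => hz1.not_ge h.2)]
      have he : Prod.mk z ⁻¹' sector c = ∅ := by
        ext w
        simp only [sector, mem_preimage, mem_ofPred_eq, mem_empty_iff_false, iff_false]
        rintro ⟨-, h1, -⟩
        nlinarith [sq_nonneg ‖w‖]
      rw [he, measure_empty]

theorem volume_sector {c : ℝ} (hc : 0 < c) (hc1 : c ≤ 1) :
    volume (sector c) = ENNReal.ofReal (2 * π / 3 * (1 - c)) := by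
  have hc2 : 0 < c ^ 2 := by positivity
  have hc21 : c ^ 2 ≤ 1 := pow_le_one₀ hc.le hc1
  rw [Measure.volume_eq_prod, Measure.prod_apply (measurableSet_sector c)]
  simp_rw [volume_sector_slice hc hc1]
  rw [lintegral_add_left ((by fun_prop : Measurable fun z : ℝ =>
      ENNReal.ofReal (π * ((1 - c ^ 2) / c ^ 2 * z ^ 2))).indicator measurableSet_Ioc),
    lintegral_indicator measurableSet_Ioc, lintegral_indicator measurableSet_Ioc,
    ← ofReal_integral_eq_lintegral_ofReal, ← ofReal_integral_eq_lintegral_ofReal,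
    ← intervalIntegral.integral_of_le hc.le, ← intervalIntegral.integral_of_le hc1,
    ← ENNReal.ofReal_add]
  · congr 1
    simp only [intervalIntegral.integral_const_mul, integral_pow]
    rw [intervalIntegral.integral_sub (by simp) (by simp)]
    simp only [integral_pow, intervalIntegral.integral_const, smul_eq_mul]
    field_simp
    push_cast
    ring
  · apply intervalIntegral.integral_nonneg hc.le
    intro z _
    exact mul_nonneg pi_pos.le (mul_nonneg (div_nonneg (by linarith) hc2.le) (sq_nonneg z))
  · apply intervalIntegral.integral_nonneg hc1
    intro z hz
    have : z ^ 2 ≤ 1 := pow_le_one₀ (hc.le.trans hz.1) hz.2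
    exact mul_nonneg pi_pos.le (by linarith)
  · exact (by fun_prop : Continuous fun z : ℝ => π * (1 - z ^ 2)).integrableOn_Ioc
  · filter_upwards [ae_restrict_mem measurableSet_Ioc] with z hz
    have : z ^ 2 ≤ 1 := pow_le_one₀ (hc.le.trans hz.1.le) hz.2
    exact mul_nonneg pi_pos.le (by linarith)
  · exact (by fun_prop : Continuous fun z : ℝ =>
      π * ((1 - c ^ 2) / c ^ 2 * z ^ 2)).integrableOn_Ioc
  · filter_upwards with z
    exact mul_nonneg pi_pos.le (mul_nonneg (div_nonneg (by linarith) hc2.le) (sq_nonneg z))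

theorem measurableSet_cap (c : ℝ) (v : E3) :
    MeasurableSet {Q : Sphere2 | c ≤ inner ℝ v (Q : E3)} :=
  (isClosed_le continuous_const (by fun_prop)).measurableSet

theorem surf_cap_first {c : ℝ} (hc : 0 < c) (hc1 : c ≤ 1) :
    surf {Q : Sphere2 | c ≤ inner ℝ (EuclideanSpace.single 0 1 : E3) (Q : E3)} =
      ENNReal.ofReal (2 * π * (1 - c)) := by
  rw [Measure.toSphere_apply' _ (measurableSet_cap c _), finrank_euclideanSpace_fin]
  have hset : Ioo (0 : ℝ) 1 •
      ((↑) '' {Q : Sphere2 | c ≤ inner ℝ (EuclideanSpace.single 0 1 : E3) (Q : E3)} : Set E3) =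
      splitFirst ⁻¹' sector c := by
    ext v
    have hn : (v 0) ^ 2 + ‖(splitFirst v).2‖ ^ 2 = ‖v‖ ^ 2 := by
      rw [EuclideanSpace.norm_sq_eq, EuclideanSpace.norm_sq_eq, Fin.sum_univ_three,
        Fin.sum_univ_two]
      simp [splitFirst]
      ring
    have hfst : (splitFirst v).1 = v 0 := rfl
    rw [mem_cone_iff]
    simp only [sector, mem_preimage, mem_ofPred_eq, hfst, hn]
    constructor
    · rintro ⟨P, hP, h0, h1, hv⟩
      have hP' : c ≤ (P : E3) 0 := by simpa [EuclideanSpace.inner_single_left] using hP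
      have hv0 : v 0 = ‖v‖ * (P : E3) 0 := by
        conv_lhs => rw [hv]
        simp
      have hcv : c * ‖v‖ ≤ v 0 := by rw [hv0, mul_comm]; gcongr
      have hcv0 : 0 < c * ‖v‖ := by positivity
      refine ⟨by positivity, pow_lt_one₀ (norm_nonneg v) h1 two_ne_zero, by linarith, ?_⟩
      rw [← mul_pow]
      gcongr
    · rintro ⟨h0, h1, h2, h3⟩
      have hv : 0 < ‖v‖ := by
        rcases (norm_nonneg v).eq_or_lt with h | h
        · rw [← h] at h0; norm_num at h0
        · exact h
      refine ⟨⟨‖v‖⁻¹ • v, ?_⟩, ?_, hv, ?_, ?_⟩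
      · rw [mem_sphere_zero_iff_norm, norm_smul, norm_inv, norm_norm, inv_mul_cancel₀ hv.ne']
      · rw [← mul_pow] at h3
        have h5 : c * ‖v‖ ≤ v 0 := (le_abs_self _).trans (abs_le_of_sq_le_sq h3 h2)
        simp only [inner_smul_right, EuclideanSpace.inner_single_left]
        simp only [map_one, one_mul]
        rw [inv_mul_eq_div, le_div_iff₀ hv]
        exact h5
      · by_contra! h
        nlinarith
      · rw [smul_smul, mul_inv_cancel₀ hv.ne', one_smul]
  rw [hset, measurePreserving_splitFirst.measure_preimage (measurableSet_sector c).nullMeasurableSet,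
    volume_sector hc hc1, ← ENNReal.ofReal_natCast, ← ENNReal.ofReal_mul (by positivity)]
  congr 1
  push_cast
  ring

/-- The area of a spherical cap of angular radius less than `π / 2`. -/
theorem surf_cap (K : Sphere2) {c : ℝ} (hc : 0 < c) (hc1 : c ≤ 1) :
    surf {Q : Sphere2 | c ≤ inner ℝ (K : E3) (Q : E3)} = ENNReal.ofReal (2 * π * (1 - c)) := by
  have hK : ‖(EuclideanSpace.single 0 1 : E3)‖ = ‖(K : E3)‖ := by
    rw [mem_sphere_zero_iff_norm.mp K.2]; simp
  -- The reflection exchanging the first axis and `K` carries one cap to the other.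
  set L : E3 ≃ₗᵢ[ℝ] E3 := (ℝ ∙ ((EuclideanSpace.single 0 1 : E3) - K))ᗮ.reflection with hL
  have hLK : L (EuclideanSpace.single 0 1) = K := Submodule.reflection_sub hK
  rw [← surf_cap_first hc hc1, ← (measurePreserving_sphereMap L).measure_preimage
    (measurableSet_cap c K).nullMeasurableSet]
  congr 1
  ext Q
  simp only [mem_preimage, mem_ofPred_eq, coe_sphereMap, ← hLK, LinearIsometryEquiv.inner_map_map]

/-! ### The geodesic distance -/

theorem norm_coe_sphere (P : Sphere2) : ‖(P : E3)‖ = 1 := mem_sphere_zero_iff_norm.mp P.2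

theorem cos_angle_sphere (P Q : Sphere2) : cos (angle (P : E3) Q) = inner ℝ (P : E3) (Q : E3) := by
  rw [InnerProductGeometry.cos_angle, norm_coe_sphere, norm_coe_sphere, mul_one, div_one]

theorem angle_sphere (P Q : Sphere2) : angle (P : E3) Q = arccos (inner ℝ (P : E3) (Q : E3)) := by
  rw [InnerProductGeometry.angle, norm_coe_sphere, norm_coe_sphere, mul_one, div_one]

theorem angle_sphere_le_iff (P Q : Sphere2) {r : ℝ} (h0 : 0 ≤ r) (hπ : r ≤ π) :
    angle (P : E3) Q ≤ r ↔ cos r ≤ inner ℝ (P : E3) (Q : E3) := by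
  rw [← cos_angle_sphere]
  exact (strictAntiOn_cos.le_iff_ge ⟨h0, hπ⟩ ⟨InnerProductGeometry.angle_nonneg _ _,
    InnerProductGeometry.angle_le_pi _ _⟩).symm

theorem gdist_nonneg (K P : Space) : 0 ≤ gdist K P := sqrt_nonneg _

theorem gdist_sq (K P : Space) :
    gdist K P ^ 2 = angle (K.1 : E3) (P.1 : E3) ^ 2 + (K.2 - P.2) ^ 2 := sq_sqrt (by positivity)

theorem gdist_le_iff (K P : Space) {R : ℝ} (hR : 0 ≤ R) :
    gdist K P ≤ R ↔ angle (K.1 : E3) (P.1 : E3) ^ 2 + (K.2 - P.2) ^ 2 ≤ R ^ 2 := Real.sqrt_le_left hR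

theorem le_gdist_iff (K P : Space) {R : ℝ} (hR : 0 ≤ R) :
    R ≤ gdist K P ↔ R ^ 2 ≤ angle (K.1 : E3) (P.1 : E3) ^ 2 + (K.2 - P.2) ^ 2 :=
  Real.le_sqrt hR (by positivity)

theorem gdist_le_gdist_iff (K K' P P' : Space) : gdist K P ≤ gdist K' P' ↔
    angle (K.1 : E3) (P.1 : E3) ^ 2 + (K.2 - P.2) ^ 2 ≤
      angle (K'.1 : E3) (P'.1 : E3) ^ 2 + (K'.2 - P'.2) ^ 2 :=
  Real.sqrt_le_sqrt_iff (by positivity)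

theorem gdist_comm (K P : Space) : gdist K P = gdist P K := by
  unfold gdist
  rw [InnerProductGeometry.angle_comm, ← neg_sq (K.2 - P.2), neg_sub]

/-- The triangle inequality for angles, combined with Cauchy–Schwarz in the plane of (angle, fibre
displacement). -/
theorem gdist_triangle (K P Q : Space) : gdist K Q ≤ gdist K P + gdist P Q := by
  have hang := InnerProductGeometry.angle_le_angle_add_angle (K.1 : E3) (P.1 : E3) (Q.1 : E3)
  have h0 := InnerProductGeometry.angle_nonneg (K.1 : E3) (Q.1 : E3)
  have h1 := gdist_sq K P
  have h2 := gdist_sq P Q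
  have n1 := gdist_nonneg K P
  have n2 := gdist_nonneg P Q
  set a := angle (K.1 : E3) (P.1 : E3)
  set b := angle (P.1 : E3) (Q.1 : E3)
  set s := K.2 - P.2 with hs
  set t := P.2 - Q.2 with ht
  rw [gdist_le_iff _ _ (add_nonneg n1 n2)]
  have hst : K.2 - Q.2 = s + t := by rw [hs, ht]; ring
  rw [hst]
  have hcs : a * b + s * t ≤ gdist K P * gdist P Q := by
    apply le_of_sq_le_sq _ (mul_nonneg n1 n2)
    rw [mul_pow, h1, h2]
    nlinarith [sq_nonneg (a * t - b * s)]
  nlinarith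

theorem gdist_act (g : Isom) (K P : Space) : gdist (act g K) (act g P) = gdist K P := by
  have h : |g.2 K.2 - g.2 P.2| = |K.2 - P.2| := by
    rw [← Real.dist_eq, ← Real.dist_eq, g.2.dist_eq]
  unfold gdist
  congr 2
  · congr 1
    exact g.1.toLinearIsometry.angle_map K.1 P.1
  · exact sq_eq_sq_iff_abs_eq_abs _ _ |>.2 h

theorem act_mul (g h : Isom) (K : Space) : act (g * h) K = act g (act h K) := rfl

theorem act_one (K : Space) : act 1 K = K := rfl

theorem act_inv_act (g : Isom) (K : Space) : act g⁻¹ (act g K) = K := by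
  rw [← act_mul, inv_mul_cancel, act_one]

theorem gdist_act_left (g h : Isom) (K : Space) :
    gdist (act g K) (act h K) = gdist K (act (g⁻¹ * h) K) := by
  rw [← gdist_act g⁻¹, act_inv_act, act_mul]

theorem continuous_gdist (K : Space) : Continuous (gdist K) := by
  have h : ∀ P : Space, angle (K.1 : E3) (P.1 : E3) = arccos (inner ℝ (K.1 : E3) (P.1 : E3)) :=
    fun P => angle_sphere _ _
  unfold gdist
  simp_rw [h]
  have h2 : Continuous fun P : Space => inner ℝ (K.1 : E3) (P.1 : E3) :=
    continuous_const.inner (continuous_subtype_val.comp continuous_fst)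
  exact (((continuous_arccos.comp h2).pow 2).add ((continuous_const.sub continuous_snd).pow 2)).sqrt

/-! ### Volume of a geodesic ball -/

theorem measurableSet_gball (K : Space) (R : ℝ) : MeasurableSet (gball K R) :=
  (isClosed_le (continuous_gdist K) continuous_const).measurableSet

/-- The volume of a geodesic ball of radius `R` is `2πR` times this quantity. -/
def ballProfile (R : ℝ) : ℝ := ∫ u in (-1 : ℝ)..1, (1 - cos (R * √(1 - u ^ 2)))

/-- The slice at level `s` is a cap of angular radius `√(R² - (K.2 - s)²)`. The bottom level,
missing from the half-open interval, is a single value of `s` and does not affect the integral. -/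
theorem surf_gball_slice (K : Space) {R : ℝ} (hR : 0 < R) (hR' : R < π / 2) {s : ℝ}
    (hs' : s ≠ -R + K.2) :
    surf ((fun Q => (Q, s)) ⁻¹' gball K R) = (Ioc (-R + K.2) (R + K.2)).indicator
      (fun s => ENNReal.ofReal (2 * π * (1 - cos √(R ^ 2 - (K.2 - s) ^ 2)))) s := by
  by_cases hs : s ∈ Ioc (-R + K.2) (R + K.2)
  · rw [indicator_of_mem hs]
    have hsq : (K.2 - s) ^ 2 ≤ R ^ 2 := by
      apply sq_le_sq'
      · linarith [hs.2]
      · linarith [hs.1]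
    have hr : √(R ^ 2 - (K.2 - s) ^ 2) ≤ R := by
      rw [Real.sqrt_le_left hR.le]; nlinarith [sq_nonneg (K.2 - s)]
    rw [← surf_cap K.1 (cos_pos_of_mem_Ioo ⟨by linarith [sqrt_nonneg (R ^ 2 - (K.2 - s) ^ 2)],
      by linarith⟩) (cos_le_one _)]
    congr 1
    ext Q
    rw [mem_preimage, mem_ofPred_eq, ← angle_sphere_le_iff _ _ (sqrt_nonneg _) (by linarith)]
    show gdist K (Q, s) ≤ R ↔ _
    rw [gdist_le_iff _ _ hR.le,
      Real.le_sqrt (InnerProductGeometry.angle_nonneg _ _) (by linarith)]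
    constructor <;> intro h <;> linarith
  · rw [indicator_of_notMem hs]
    have : (fun Q : Sphere2 => (Q, s)) ⁻¹' gball K R = ∅ := by
      ext Q
      simp only [mem_preimage, mem_empty_iff_false, iff_false]
      intro h
      have h : gdist K (Q, s) ≤ R := h
      rw [gdist_le_iff _ _ hR.le] at h
      have h2 := abs_le_of_sq_le_sq' (show (K.2 - s) ^ 2 ≤ R ^ 2 by
        nlinarith [sq_nonneg (angle (K.1 : E3) (Q : E3))]) hR.le
      exact hs ⟨lt_of_le_of_ne (by linarith [h2.2]) hs'.symm, by linarith [h2.1]⟩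
    rw [this, measure_empty]

theorem vol_gball (K : Space) {R : ℝ} (hR : 0 < R) (hR' : R < π / 2) :
    vol (gball K R) = ENNReal.ofReal (2 * π * R * ballProfile R) := by
  have hcont : Continuous fun s : ℝ => 2 * π * (1 - cos √(R ^ 2 - (K.2 - s) ^ 2)) := by fun_prop
  rw [vol, Measure.prod_apply_symm (measurableSet_gball K R)]
  have hae : ∀ᵐ s : ℝ, surf ((fun Q => (Q, s)) ⁻¹' gball K R) =
      (Ioc (-R + K.2) (R + K.2)).indicator
      (fun s => ENNReal.ofReal (2 * π * (1 - cos √(R ^ 2 - (K.2 - s) ^ 2)))) s := by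
    filter_upwards [measure_eq_zero_iff_ae_notMem.1 (measure_singleton (μ := volume) (-R + K.2))]
      with s hs
    exact surf_gball_slice K hR hR' hs
  rw [lintegral_congr_ae hae, lintegral_indicator measurableSet_Ioc,
    ← ofReal_integral_eq_lintegral_ofReal hcont.integrableOn_Ioc,
    ← intervalIntegral.integral_of_le (by linarith)]
  · congr 1
    -- The substitution `s = R * u + K.2` moves the integral to `[-1, 1]`, where `R` enters only
    -- through `R * √(1 - u ^ 2)`.
    have h := intervalIntegral.smul_integral_comp_mul_add
      (fun s : ℝ => 2 * π * (1 - cos √(R ^ 2 - (K.2 - s) ^ 2))) (a := -1) (b := 1) R K.2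
    rw [mul_neg, mul_one] at h
    rw [← h, ballProfile, intervalIntegral.integral_const_mul, smul_eq_mul]
    have : ∀ u : ℝ, √(R ^ 2 - (K.2 - (R * u + K.2)) ^ 2) = R * √(1 - u ^ 2) := by
      intro u
      rw [show R ^ 2 - (K.2 - (R * u + K.2)) ^ 2 = R ^ 2 * (1 - u ^ 2) by ring,
        Real.sqrt_mul (sq_nonneg R), Real.sqrt_sq hR.le]
    simp_rw [this]
    ring
  · filter_upwards with s
    exact mul_nonneg (by positivity) (by linarith [cos_le_one √(R ^ 2 - (K.2 - s) ^ 2)])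

/-! ### Elements of the space group as signs and translations -/

theorem inner_eq_coords (v w : E3) : inner ℝ v w = v 0 * w 0 + v 1 * w 1 + v 2 * w 2 := by
  rw [PiLp.inner_apply, Fin.sum_univ_three]
  simp [mul_comm]

theorem sum_sq_coords (P : Sphere2) :
    (P : E3) 0 ^ 2 + (P : E3) 1 ^ 2 + (P : E3) 2 ^ 2 = 1 := by
  have h := real_inner_self_eq_norm_sq (P : E3)
  rw [norm_coe_sphere, inner_eq_coords] at h
  linarith

/-- `g` multiplies the coordinates by the signs `a`, `b`, `(-1) ^ k` and translates the fibre
by `k * τ`. -/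
structure IsSigned (τ : ℝ) (g : Isom) (a b : ℝ) (k : ℤ) : Prop where
  sign_zero : a = 1 ∨ a = -1
  sign_one : b = 1 ∨ b = -1
  coord_zero : ∀ v, g.1 v 0 = a * v 0
  coord_one : ∀ v, g.1 v 1 = b * v 1
  coord_two : ∀ v, g.1 v 2 = (-1) ^ k * v 2
  fibre : ∀ t, g.2 t = t + k * τ

theorem isSigned_one (τ : ℝ) : IsSigned τ 1 1 1 0 :=
  ⟨Or.inl rfl, Or.inl rfl, fun v => by simp, fun v => by simp, fun v => by simp, fun t => by simp⟩

theorem isSigned_g₁ (τ : ℝ) : IsSigned τ g₁ (-1) 1 0 :=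
  ⟨Or.inr rfl, Or.inl rfl, fun v => by simp [g₁, mirror_apply], fun v => by simp [g₁, mirror_apply],
    fun v => by simp [g₁, mirror_apply], fun t => by simp [g₁]⟩

theorem isSigned_g₂ (τ : ℝ) : IsSigned τ g₂ 1 (-1) 0 :=
  ⟨Or.inl rfl, Or.inr rfl, fun v => by simp [g₂, mirror_apply], fun v => by simp [g₂, mirror_apply],
    fun v => by simp [g₂, mirror_apply], fun t => by simp [g₂]⟩

theorem isSigned_τg₃ (τ : ℝ) : IsSigned τ (τg₃ τ) 1 1 1 :=
  ⟨Or.inl rfl, Or.inl rfl, fun v => by simp [τg₃, mirror_apply],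
    fun v => by simp [τg₃, mirror_apply],
    fun v => by simp [τg₃, mirror_apply], fun t => by simp [τg₃]⟩

theorem isSigned_fibreTranslation (τ : ℝ) : IsSigned τ (fibreTranslation (2 * τ)) 1 1 2 :=
  ⟨Or.inl rfl, Or.inl rfl, fun v => by simp [fibreTranslation], fun v => by simp [fibreTranslation],
    fun v => by simp [fibreTranslation], fun t => by simp [fibreTranslation]⟩

theorem mul_sign {a b : ℝ} (ha : a = 1 ∨ a = -1) (hb : b = 1 ∨ b = -1) :
    a * b = 1 ∨ a * b = -1 := by
  rcases ha with rfl | rfl <;> rcases hb with rfl | rfl <;> simp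

theorem IsSigned.mul {τ : ℝ} {g h : Isom} {a b c d : ℝ} {k l : ℤ} (hg : IsSigned τ g a b k)
    (hh : IsSigned τ h c d l) : IsSigned τ (g * h) (a * c) (b * d) (k + l) where
  sign_zero := mul_sign hg.sign_zero hh.sign_zero
  sign_one := mul_sign hg.sign_one hh.sign_one
  coord_zero v := by
    show g.1 (h.1 v) 0 = _
    rw [hg.coord_zero, hh.coord_zero, mul_assoc]
  coord_one v := by
    show g.1 (h.1 v) 1 = _
    rw [hg.coord_one, hh.coord_one, mul_assoc]
  coord_two v := by
    show g.1 (h.1 v) 2 = _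
    rw [hg.coord_two, hh.coord_two, zpow_add₀ (by norm_num), mul_assoc]
  fibre t := by
    show g.2 (h.2 t) = _
    rw [hg.fibre, hh.fibre]
    push_cast
    ring

theorem IsSigned.inv {τ : ℝ} {g : Isom} {a b : ℝ} {k : ℤ} (hg : IsSigned τ g a b k) :
    IsSigned τ g⁻¹ a b (-k) where
  sign_zero := hg.sign_zero
  sign_one := hg.sign_one
  coord_zero v := by
    have h := hg.coord_zero (g⁻¹.1 v)
    rw [show g.1 (g⁻¹.1 v) = v from g.1.apply_symm_apply v] at h
    rcases hg.sign_zero with rfl | rfl <;> linarith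
  coord_one v := by
    have h := hg.coord_one (g⁻¹.1 v)
    rw [show g.1 (g⁻¹.1 v) = v from g.1.apply_symm_apply v] at h
    rcases hg.sign_one with rfl | rfl <;> linarith
  coord_two v := by
    have h := hg.coord_two (g⁻¹.1 v)
    rw [show g.1 (g⁻¹.1 v) = v from g.1.apply_symm_apply v] at h
    rw [h, ← mul_assoc, ← zpow_add₀ (by norm_num), neg_add_cancel, zpow_zero, one_mul]
  fibre t := by
    have h := hg.fibre (g⁻¹.2 t)
    rw [show g.2 (g⁻¹.2 t) = t from g.2.apply_symm_apply t] at h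
    push_cast
    linarith

/-- The third sign is tied to the parity of `k`, because only the glide reflection changes either.
The converse, that every such triple occurs, is not needed. -/
theorem exists_isSigned {τ : ℝ} {g : Isom} (hg : g ∈ spaceGroup τ) :
    ∃ a b k, IsSigned τ g a b k := by
  induction hg using Subgroup.closure_induction with
  | mem x hx =>
    rcases hx with rfl | rfl | rfl
    · exact ⟨_, _, _, isSigned_g₁ τ⟩
    · exact ⟨_, _, _, isSigned_g₂ τ⟩
    · exact ⟨_, _, _, isSigned_τg₃ τ⟩
  | one => exact ⟨_, _, _, isSigned_one τ⟩
  | mul x y _ _ hx hy =>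
    obtain ⟨a, b, k, h⟩ := hx
    obtain ⟨c, d, l, h'⟩ := hy
    exact ⟨_, _, _, h.mul h'⟩
  | inv x _ hx =>
    obtain ⟨a, b, k, h⟩ := hx
    exact ⟨_, _, _, h.inv⟩

theorem IsSigned.eq {τ : ℝ} {g h : Isom} {a b : ℝ} {k : ℤ} (hg : IsSigned τ g a b k)
    (hh : IsSigned τ h a b k) : g = h := by
  apply Prod.ext
  · ext v i
    fin_cases i
    · exact (hg.coord_zero v).trans (hh.coord_zero v).symm
    · exact (hg.coord_one v).trans (hh.coord_one v).symm
    · exact (hg.coord_two v).trans (hh.coord_two v).symm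
  · ext t
    rw [hg.fibre, hh.fibre]

theorem g₁_mem (τ : ℝ) : g₁ ∈ spaceGroup τ := Subgroup.subset_closure (by simp)
theorem g₂_mem (τ : ℝ) : g₂ ∈ spaceGroup τ := Subgroup.subset_closure (by simp)
theorem τg₃_mem (τ : ℝ) : τg₃ τ ∈ spaceGroup τ := Subgroup.subset_closure (by simp)

theorem inner_act {τ : ℝ} {g : Isom} {a b : ℝ} {k : ℤ} (hg : IsSigned τ g a b k)
    (K : Space) (P : E3) : inner ℝ ((act g K).1 : E3) P =
      a * ((K.1 : E3) 0 * P 0) + b * ((K.1 : E3) 1 * P 1) + (-1) ^ k * ((K.1 : E3) 2 * P 2) := by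
  rw [inner_eq_coords]
  show g.1 K.1 0 * _ + g.1 K.1 1 * _ + g.1 K.1 2 * _ = _
  rw [hg.coord_zero, hg.coord_one, hg.coord_two]
  ring

theorem act_snd {τ : ℝ} {g : Isom} {a b : ℝ} {k : ℤ} (hg : IsSigned τ g a b k)
    (K : Space) : (act g K).2 = K.2 + k * τ := hg.fibre _

/-- Points on the mirrors of `g₁` and `g₂` are fixed by them. Nothing is claimed of the third
coordinate, since the glide reflection fixes no point when `τ ≠ 0`. -/
theorem coords_ne_zero {τ : ℝ} {K : Space} (h : IsSimplyTransitive (spaceGroup τ) K) :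
    (K.1 : E3) 0 ≠ 0 ∧ (K.1 : E3) 1 ≠ 0 := by
  constructor
  · intro h0
    have hfix : act g₁ K = K := by
      apply Prod.ext
      · ext i
        show mirror 0 K.1 i = _
        rw [mirror_apply]
        split_ifs with hi
        · subst hi; linarith
        · rfl
      · rfl
    have := h g₁ (g₁_mem τ) hfix
    have h1 := (isSigned_g₁ τ).coord_zero (EuclideanSpace.single 0 1)
    rw [this] at h1
    norm_num at h1
  · intro h0
    have hfix : act g₂ K = K := by
      apply Prod.ext
      · ext i
        show mirror 1 K.1 i = _
        rw [mirror_apply]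
        split_ifs with hi
        · subst hi; linarith
        · rfl
      · rfl
    have := h g₂ (g₂_mem τ) hfix
    have h1 := (isSigned_g₂ τ).coord_one (EuclideanSpace.single 1 1)
    rw [this] at h1
    norm_num at h1

theorem isSimplyTransitive_of_coords_ne_zero {τ : ℝ} (hτ : 0 < τ) {K : Space}
    (h0 : (K.1 : E3) 0 ≠ 0) (h1 : (K.1 : E3) 1 ≠ 0) : IsSimplyTransitive (spaceGroup τ) K := by
  intro g hg hfix
  obtain ⟨a, b, k, h⟩ := exists_isSigned hg
  have hfst : g.1 K.1 = K.1 := congrArg (fun P : Space => (P.1 : E3)) hfix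
  have hk : k = 0 := by
    have h2 := act_snd h K
    rw [hfix] at h2
    have : (k : ℝ) * τ = 0 := by linarith
    rcases mul_eq_zero.1 this with h | h
    · exact_mod_cast h
    · exact absurd h hτ.ne'
  have ha : a = 1 := by
    have h2 := h.coord_zero K.1
    rw [hfst] at h2
    exact mul_right_cancel₀ h0 (by linarith)
  have hb : b = 1 := by
    have h2 := h.coord_one K.1
    rw [hfst] at h2
    exact mul_right_cancel₀ h1 (by linarith)
  subst hk ha hb
  exact h.eq (isSigned_one τ)

/-! ### The packing condition as four inequalities -/

theorem abs_coord_le_one (P : Sphere2) (i : Fin 3) : |(P : E3) i| ≤ 1 := by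
  have := sum_sq_coords P
  rw [abs_le_one_iff_mul_self_le_one]
  fin_cases i <;>
  simp only [Fin.zero_eta, Fin.mk_one, Fin.reduceFinMk] <;>
  nlinarith [sq_nonneg ((P : E3) 0), sq_nonneg ((P : E3) 1), sq_nonneg ((P : E3) 2)]

/-- The half-angle formula: a point at distance `arcsin a` from a great circle is at distance `2 *
arcsin a` from its mirror image. -/
theorem arccos_one_sub_two_mul_sq {a : ℝ} (h0 : 0 ≤ a) (h1 : a ≤ 1) :
    arccos (1 - 2 * a ^ 2) = 2 * arcsin a := by
  have h2 := arcsin_le_pi_div_two a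
  have h3 := arcsin_nonneg.2 h0
  rw [← arccos_cos (show 0 ≤ 2 * arcsin a by linarith) (by linarith), cos_two_mul,
    cos_sq', sin_arcsin (by linarith) h1]
  congr 1
  ring

theorem two_mul_arcsin_le_angle (P Q : Sphere2) {a : ℝ} (h0 : 0 ≤ a) (h1 : a ≤ 1)
    (h : inner ℝ (P : E3) (Q : E3) ≤ 1 - 2 * a ^ 2) : 2 * arcsin a ≤ angle (P : E3) Q := by
  rw [angle_sphere, ← arccos_one_sub_two_mul_sq h0 h1]
  exact arccos_le_arccos h

theorem angle_le_gdist (K P : Space) : angle (K.1 : E3) (P.1 : E3) ≤ gdist K P := by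
  apply Real.le_sqrt_of_sq_le
  nlinarith [sq_nonneg (K.2 - P.2)]

/-- The inequalities on the kernel point and the glide length which make the balls of radius `R`
around the orbit of `K` a packing. -/
structure Admissible (τ : ℝ) (K : Space) (R : ℝ) : Prop where
  le_zero : R ≤ arcsin |(K.1 : E3) 0|
  le_one : R ≤ arcsin |(K.1 : E3) 1|
  le_two : 4 * R ^ 2 ≤ 4 * arcsin |(K.1 : E3) 2| ^ 2 + τ ^ 2
  le_translation : R ≤ τ

/-- A sign `-1` in the first or second place already gives enough angular distance. With both signs
`+1`, an even `k ≠ 0` has `|k| ≥ 2` and moves the fibre by at least `2τ`, while an odd `k` combines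
the reflection in `z = 0` with a shift of at least `τ`. -/
theorem Admissible.two_mul_le_gdist {τ : ℝ} {K : Space} {R : ℝ} (hR : 0 < R)
    (h : Admissible τ K R) {g : Isom} (hg : g ∈ spaceGroup τ) (hne : act g K ≠ K) :
    2 * R ≤ gdist K (act g K) := by
  obtain ⟨a, b, k, hs⟩ := exists_isSigned hg
  have hsum := sum_sq_coords K.1
  have hin : inner ℝ (K.1 : E3) ((act g K).1 : E3) = a * (K.1 : E3) 0 ^ 2 + b * (K.1 : E3) 1 ^ 2 +
      (-1) ^ k * (K.1 : E3) 2 ^ 2 := by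
    rw [real_inner_comm, inner_act hs]; ring
  have hk1 : ((-1 : ℝ) ^ k) ≤ 1 := by
    rcases Int.even_or_odd k with hk | hk
    · rw [hk.neg_one_zpow]
    · rw [hk.neg_one_zpow]; norm_num
  have ha1 : a ≤ 1 := by rcases hs.sign_zero with rfl | rfl <;> norm_num
  have hb1 : b ≤ 1 := by rcases hs.sign_one with rfl | rfl <;> norm_num
  have hx := mul_le_mul_of_nonneg_right ha1 (sq_nonneg ((K.1 : E3) 0))
  have hy := mul_le_mul_of_nonneg_right hb1 (sq_nonneg ((K.1 : E3) 1))
  have hz := mul_le_mul_of_nonneg_right hk1 (sq_nonneg ((K.1 : E3) 2))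
  rcases hs.sign_zero with rfl | rfl
  swap
  · have := two_mul_arcsin_le_angle K.1 (act g K).1 (abs_nonneg ((K.1 : E3) 0))
      (abs_coord_le_one _ _) (by rw [hin, sq_abs]; linarith)
    linarith [h.le_zero, angle_le_gdist K (act g K)]
  rcases hs.sign_one with rfl | rfl
  swap
  · have := two_mul_arcsin_le_angle K.1 (act g K).1 (abs_nonneg ((K.1 : E3) 1))
      (abs_coord_le_one _ _) (by rw [hin, sq_abs]; linarith)
    linarith [h.le_one, angle_le_gdist K (act g K)]
  rw [le_gdist_iff _ _ (by linarith), act_snd hs]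
  rcases Int.even_or_odd k with hk | hk
  · have hk0 : k ≠ 0 := by
      rintro rfl
      apply hne
      rw [hs.eq (isSigned_one τ), act_one]
    have hk2 : (4 : ℝ) ≤ (k : ℝ) ^ 2 := by
      obtain ⟨m, rfl⟩ := hk
      have : 1 ≤ m ^ 2 := by
        have : m ≠ 0 := by rintro rfl; simp at hk0
        exact Order.one_le_iff_pos.2 (by positivity)
      have : (1 : ℝ) ≤ (m : ℝ) ^ 2 := by exact_mod_cast this
      push_cast
      nlinarith
    have h1 : R ^ 2 ≤ τ ^ 2 := pow_le_pow_left₀ hR.le h.le_translation 2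
    nlinarith [sq_nonneg (angle (K.1 : E3) ((act g K).1 : E3)), sq_nonneg τ,
      mul_le_mul_of_nonneg_right hk2 (sq_nonneg τ)]
  · have := two_mul_arcsin_le_angle K.1 (act g K).1 (abs_nonneg ((K.1 : E3) 2))
      (abs_coord_le_one _ _) (by rw [hin, sq_abs, hk.neg_one_zpow]; linarith)
    have hsq := pow_le_pow_left₀ (by have := arcsin_nonneg.2 (abs_nonneg ((K.1 : E3) 2)); linarith)
      this 2
    have hk2 : (1 : ℝ) ≤ (k : ℝ) ^ 2 := by
      have : k ≠ 0 := by rintro rfl; simp at hk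
      have : 1 ≤ k ^ 2 := Order.one_le_iff_pos.2 (by positivity)
      exact_mod_cast this
    nlinarith [h.le_two, mul_le_mul_of_nonneg_right hk2 (sq_nonneg τ)]

theorem Admissible.isBallPacking {τ : ℝ} {K : Space} {R : ℝ} (hR : 0 < R)
    (h : Admissible τ K R) : IsBallPacking (spaceGroup τ) K R := by
  refine ⟨hR, fun g hg g' hg' hne => ?_⟩
  rw [Set.disjoint_left]
  intro P hP hP'
  have hP : gdist (act g K) P < R := hP
  have hP' : gdist (act g' K) P < R := hP'
  have h1 : 2 * R ≤ gdist (act g K) (act g' K) := by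
    rw [gdist_act_left]
    apply h.two_mul_le_gdist hR ((spaceGroup τ).mul_mem ((spaceGroup τ).inv_mem hg) hg')
    intro h2
    apply hne
    conv_lhs => rw [← h2]
    rw [← act_mul, mul_inv_cancel_left]
  have h2 := gdist_triangle (act g K) P (act g' K)
  rw [gdist_comm P] at h2
  linarith

theorem arccos_sqrt_one_sub_sq {a : ℝ} (h0 : 0 ≤ a) : arccos √(1 - a ^ 2) = arcsin a :=
  (arcsin_eq_arccos h0).symm

/-- The foot of the perpendicular from `K` to the `i`-th coordinate great circle. -/
theorem exists_foot (K : Sphere2) (i : Fin 3) (hi : (K : E3) i ^ 2 < 1) :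
    ∃ M : Sphere2, sphereMap (mirror i) M = M ∧ angle (K : E3) M = arcsin |(K : E3) i| := by
  have hs : 0 < √(1 - (K : E3) i ^ 2) := sqrt_pos.2 (by linarith)
  set m : E3 := (K : E3) - (K : E3) i • EuclideanSpace.single i 1 with hm
  have hKm : inner ℝ (K : E3) m = 1 - (K : E3) i ^ 2 := by
    rw [hm, inner_sub_right, inner_smul_right, real_inner_self_eq_norm_sq, norm_coe_sphere,
      EuclideanSpace.inner_single_right]
    simp
    ring
  have hmi : m i = 0 := by simp [hm]
  have hmm : ‖m‖ ^ 2 = 1 - (K : E3) i ^ 2 := by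
    rw [← real_inner_self_eq_norm_sq]
    conv_lhs => rw [hm]
    rw [inner_sub_left, inner_smul_left, hKm, EuclideanSpace.inner_single_left, hmi]
    simp
  have hnorm : ‖m‖ = √(1 - (K : E3) i ^ 2) := by rw [← hmm, sqrt_sq (norm_nonneg m)]
  refine ⟨⟨‖m‖⁻¹ • m, ?_⟩, ?_, ?_⟩
  · rw [mem_sphere_zero_iff_norm, norm_smul, norm_inv, norm_norm, inv_mul_cancel₀]
    rw [hnorm]; exact hs.ne'
  · ext j
    rw [coe_sphereMap, mirror_apply]
    split_ifs with hj
    · subst hj; simp [hmi]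
    · rfl
  · rw [angle_sphere, inner_smul_right, hKm, ← arccos_sqrt_one_sub_sq (abs_nonneg _), sq_abs, hnorm]
    congr 1
    rw [inv_mul_eq_div, div_sqrt]

/-- Each inequality is tested at a midpoint of `K` and a neighbour: if it failed, the midpoint would
be interior to both balls. -/
theorem admissible_of_isBallPacking {τ : ℝ} (hτ : 0 < τ) {K : Space} {R : ℝ}
    (h0 : (K.1 : E3) 0 ≠ 0) (h1 : (K.1 : E3) 1 ≠ 0)
    (h : IsBallPacking (spaceGroup τ) K R) : Admissible τ K R := by
  obtain ⟨hR, h⟩ := h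
  have hsum := sum_sq_coords K.1
  have h0' : 0 < (K.1 : E3) 0 ^ 2 := by positivity
  have h1' : 0 < (K.1 : E3) 1 ^ 2 := by positivity
  -- If `g` sends `Q` to `P`, then `P` is as far from `act g K` as `Q` is from `K`. So it is enough
  -- to find `P` and `Q` equally far from `K`.
  have key : ∀ g ∈ spaceGroup τ, act g K ≠ K → ∀ P Q : Space, act g Q = P →
      gdist K Q = gdist K P → R ≤ gdist K P := by
    intro g hg hne P Q hQP hd
    by_contra! hlt
    refine Set.disjoint_left.1 (h 1 (one_mem _) g hg hne.symm) (show P ∈ openGball (act 1 K) R from hlt) ?_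
    show gdist (act g K) P < R
    rwa [← hQP, gdist_act, hd]
  refine ⟨?_, ?_, ?_, ?_⟩
  · obtain ⟨M, hM, hMa⟩ := exists_foot K.1 0 (by nlinarith [sq_nonneg ((K.1 : E3) 2)])
    have hne : act g₁ K ≠ K := by
      intro h2
      have h3 : g₁.1 K.1 = K.1 := congrArg (fun P : Space => (P.1 : E3)) h2
      have h4 := (isSigned_g₁ τ).coord_zero K.1
      rw [h3] at h4
      apply h0
      linarith
    have h2 := key g₁ (g₁_mem τ) hne (M, K.2) (M, K.2) (Prod.ext hM rfl) rfl
    rwa [gdist, hMa, sub_self, zero_pow two_ne_zero, add_zero,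
      sqrt_sq (arcsin_nonneg.2 (abs_nonneg _))] at h2
  · obtain ⟨M, hM, hMa⟩ := exists_foot K.1 1 (by nlinarith [sq_nonneg ((K.1 : E3) 2)])
    have hne : act g₂ K ≠ K := by
      intro h2
      have h3 : g₂.1 K.1 = K.1 := congrArg (fun P : Space => (P.1 : E3)) h2
      have h4 := (isSigned_g₂ τ).coord_one K.1
      rw [h3] at h4
      apply h1
      linarith
    have h2 := key g₂ (g₂_mem τ) hne (M, K.2) (M, K.2) (Prod.ext hM rfl) rfl
    rwa [gdist, hMa, sub_self, zero_pow two_ne_zero, add_zero,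
      sqrt_sq (arcsin_nonneg.2 (abs_nonneg _))] at h2
  · obtain ⟨M, hM, hMa⟩ := exists_foot K.1 2 (by nlinarith)
    have hne : act (τg₃ τ) K ≠ K := by
      intro h2
      have h4 := act_snd (isSigned_τg₃ τ) K
      rw [h2] at h4
      push_cast at h4
      linarith
    -- The foot on the equator is fixed by the mirror, so shifting it by `τ / 2` up and down gives a
    -- pair exchanged by the glide.
    have h2 := key (τg₃ τ) (τg₃_mem τ) hne (M, K.2 + τ / 2) (M, K.2 - τ / 2)
      (Prod.ext hM (by
        show K.2 - τ / 2 + τ = K.2 + τ / 2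
        ring)) (by unfold gdist; congr 2; ring)
    rw [le_gdist_iff _ _ hR.le, hMa] at h2
    nlinarith
  · have hs : IsSigned τ (τg₃ τ * τg₃ τ) _ _ _ := (isSigned_τg₃ τ).mul (isSigned_τg₃ τ)
    have hne : act (τg₃ τ * τg₃ τ) K ≠ K := by
      intro h2
      have h4 := act_snd hs K
      rw [h2] at h4
      push_cast at h4
      linarith
    have h2 := key (τg₃ τ * τg₃ τ) (mul_mem (τg₃_mem τ) (τg₃_mem τ)) hne (K.1, K.2 + τ)
      (K.1, K.2 - τ) (Prod.ext (by
        ext j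
        show mirror 2 (mirror 2 K.1) j = _
        rw [mirror_apply, mirror_apply]
        split_ifs <;> simp) (by
        rw [act_snd hs]
        push_cast
        ring)) (by unfold gdist; congr 2; ring)
    rw [gdist, InnerProductGeometry.angle_self (by
      rw [← norm_ne_zero_iff, norm_coe_sphere]; norm_num)] at h2
    rw [show (0 : ℝ) ^ 2 + (K.2 - (K.2 + τ)) ^ 2 = τ ^ 2 by ring, sqrt_sq hτ.le] at h2
    exact h2

/-! ### The Dirichlet–Voronoi cell and its volume -/

theorem inner_sphereMap_two (K P : Sphere2) :
    inner ℝ (K : E3) (sphereMap (mirror 2) P : E3) =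
      (K : E3) 0 * (P : E3) 0 + (K : E3) 1 * (P : E3) 1 - (K : E3) 2 * (P : E3) 2 := by
  rw [inner_eq_coords, coe_sphereMap, mirror_apply, mirror_apply, mirror_apply]
  simp
  ring

/-- Half the length of the fibre of the Dirichlet–Voronoi cell of `K` over `Q`, when positive. -/
def cellHeight (τ : ℝ) (K Q : Sphere2) : ℝ :=
  min τ ((τ ^ 2 + angle (K : E3) (sphereMap (mirror 2) Q) ^ 2 - angle (K : E3) Q ^ 2) / (2 * τ))

theorem angle_le_angle_iff_inner (K L P Q : Sphere2) :
    angle (K : E3) P ≤ angle (L : E3) Q ↔ inner ℝ (L : E3) (Q : E3) ≤ inner ℝ (K : E3) (P : E3) := by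
  rw [angle_sphere_le_iff _ _ (InnerProductGeometry.angle_nonneg _ _)
    (InnerProductGeometry.angle_le_pi _ _), cos_angle_sphere]

/-- Comparison with `g₁` and `g₂` confines the base point to a quarter sphere. Comparison with the
glide and its inverse gives the bisector bound in `cellHeight`, and comparison with their squares
gives the bound `τ`. -/
theorem dvCell_subset {τ : ℝ} (hτ : 0 < τ) {K P : Space} (hP : P ∈ dvCell (spaceGroup τ) K) :
    P.1 ∈ quarter ((K.1 : E3) 0) ((K.1 : E3) 1) ∧ |P.2 - K.2| ≤ cellHeight τ K.1 P.1 := by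
  have key : ∀ g ∈ spaceGroup τ, ∀ a b k, IsSigned τ g a b k →
      angle (K.1 : E3) (P.1 : E3) ^ 2 + (K.2 - P.2) ^ 2 ≤
      angle ((act g K).1 : E3) (P.1 : E3) ^ 2 + (K.2 + k * τ - P.2) ^ 2 := by
    intro g hg a b k hs
    have h := hP g hg
    rwa [gdist_le_gdist_iff, act_snd hs] at h
  have hhoriz : ∀ g ∈ spaceGroup τ, ∀ a b, IsSigned τ g a b 0 →
      inner ℝ ((act g K).1 : E3) (P.1 : E3) ≤ inner ℝ (K.1 : E3) (P.1 : E3) := by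
    intro g hg a b hs
    have h := key g hg a b 0 hs
    rw [← angle_le_angle_iff_inner]
    apply le_of_sq_le_sq _ (InnerProductGeometry.angle_nonneg _ _)
    push_cast at h
    nlinarith
  have h3 := isSigned_τg₃ τ
  have hodd : ∀ (g : Isom) (k : ℤ), IsSigned τ g 1 1 k → Odd k →
      angle ((act g K).1 : E3) (P.1 : E3) = angle (K.1 : E3) (sphereMap (mirror 2) P.1) := by
    intro g k hs hk
    rw [angle_sphere, angle_sphere, inner_act hs, inner_sphereMap_two, hk.neg_one_zpow]
    congr 1
    ring
  have heven : ∀ (g : Isom) (k : ℤ), IsSigned τ g 1 1 k → Even k →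
      angle ((act g K).1 : E3) (P.1 : E3) = angle (K.1 : E3) (P.1 : E3) := by
    intro g k hs hk
    rw [angle_sphere, angle_sphere, inner_act hs, inner_eq_coords, hk.neg_one_zpow]
    congr 1
    ring
  have m3 := τg₃_mem τ
  have s1 : IsSigned τ (τg₃ τ) 1 1 1 := h3
  have s2 : IsSigned τ (τg₃ τ)⁻¹ 1 1 (-1) := h3.inv
  have s3 : IsSigned τ (τg₃ τ * τg₃ τ) 1 1 2 := by simpa using h3.mul h3
  have s4 : IsSigned τ (τg₃ τ * τg₃ τ)⁻¹ 1 1 (-2) := s3.inv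
  have k1 := key _ m3 _ _ _ s1
  have k2 := key _ (inv_mem m3) _ _ _ s2
  have k3 := key _ (mul_mem m3 m3) _ _ _ s3
  have k4 := key _ (inv_mem (mul_mem m3 m3)) _ _ _ s4
  rw [hodd _ _ s1 (by decide)] at k1
  rw [hodd _ _ s2 (by decide)] at k2
  rw [heven _ _ s3 (by decide)] at k3
  rw [heven _ _ s4 (by decide)] at k4
  push_cast at k1 k2 k3 k4
  refine ⟨⟨?_, ?_⟩, ?_⟩
  · have h := hhoriz g₁ (g₁_mem τ) _ _ (isSigned_g₁ τ)
    rw [inner_act (isSigned_g₁ τ), inner_eq_coords, zpow_zero] at h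
    linarith
  · have h := hhoriz g₂ (g₂_mem τ) _ _ (isSigned_g₂ τ)
    rw [inner_act (isSigned_g₂ τ), inner_eq_coords, zpow_zero] at h
    linarith
  · apply le_min
    · rw [abs_le]
      constructor <;> by_contra! <;> nlinarith
    · rw [le_div_iff₀ (by linarith)]
      rcases abs_cases (P.2 - K.2) with ⟨h, -⟩ | ⟨h, -⟩ <;> rw [h] <;> nlinarith

/-- The comparisons of `dvCell_subset` imply all others: in the quarter, sign changes only increase
the angle, and for either parity of `k` the binding shift is the shortest nontrivial one. -/
theorem mem_dvCell {τ : ℝ} (hτ : 0 < τ) {K P : Space}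
    (hq : P.1 ∈ quarter ((K.1 : E3) 0) ((K.1 : E3) 1)) (hh : |P.2 - K.2| ≤ cellHeight τ K.1 P.1) :
    P ∈ dvCell (spaceGroup τ) K := by
  intro g hg
  obtain ⟨a, b, k, hs⟩ := exists_isSigned hg
  obtain ⟨hq0, hq1⟩ := hq
  have hh1 : |P.2 - K.2| ≤ τ := hh.trans (min_le_left _ _)
  have hh2 := hh.trans (min_le_right _ _)
  rw [le_div_iff₀ (by linarith)] at hh2
  have ha1 : a ≤ 1 := by rcases hs.sign_zero with rfl | rfl <;> norm_num
  have hb1 : b ≤ 1 := by rcases hs.sign_one with rfl | rfl <;> norm_num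
  have hx := mul_le_mul_of_nonneg_right ha1 hq0
  have hy := mul_le_mul_of_nonneg_right hb1 hq1
  rw [gdist_le_gdist_iff, act_snd hs]
  have hs0 : 0 ≤ |P.2 - K.2| := abs_nonneg _
  have hexp : (K.2 + k * τ - P.2) ^ 2 = (K.2 - P.2) ^ 2 + (|(k : ℝ)| * τ) ^ 2 -
      2 * (k * τ * (P.2 - K.2)) := by
    rw [mul_pow, sq_abs]; ring
  have hle : k * τ * (P.2 - K.2) ≤ |(k : ℝ)| * τ * |P.2 - K.2| := by
    rw [← abs_of_pos hτ, ← abs_mul, abs_of_pos hτ, ← abs_mul]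
    exact le_abs_self _
  have hk0 : 0 ≤ |(k : ℝ)| := abs_nonneg _
  rcases Int.even_or_odd k with hk | hk
  · have hang : angle (K.1 : E3) P.1 ≤ angle ((act g K).1 : E3) P.1 := by
      rw [angle_le_angle_iff_inner, inner_act hs, hk.neg_one_zpow, inner_eq_coords]
      linarith
    have hang2 := pow_le_pow_left₀ (InnerProductGeometry.angle_nonneg _ _) hang 2
    have : |(k : ℝ)| = 0 ∨ 2 ≤ |(k : ℝ)| := by
      have : |k| = 0 ∨ 2 ≤ |k| := by
        obtain ⟨m, rfl⟩ := hk
        rcases eq_or_ne m 0 with rfl | hm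
        · left; simp
        · right
          have := Int.one_le_abs hm
          rw [← two_mul, abs_mul, abs_two]
          linarith
      rw [← Int.cast_abs]
      exact_mod_cast this
    rw [hexp]
    rcases this with h | h
    · rw [h] at hle ⊢
      nlinarith
    · have h1 : |(k : ℝ)| * τ * |P.2 - K.2| ≤ |(k : ℝ)| * τ * τ := by gcongr
      have h2 : |(k : ℝ)| * τ * (2 * τ) ≤ |(k : ℝ)| * τ * (|(k : ℝ)| * τ) := by gcongr
      nlinarith
  · have hang : angle (K.1 : E3) (sphereMap (mirror 2) P.1) ≤ angle ((act g K).1 : E3) P.1 := by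
      rw [angle_le_angle_iff_inner, inner_act hs, hk.neg_one_zpow, inner_sphereMap_two]
      linarith
    have hang2 := pow_le_pow_left₀ (InnerProductGeometry.angle_nonneg _ _) hang 2
    have h1 : 1 ≤ |(k : ℝ)| := by
      have : k ≠ 0 := by rintro rfl; simp at hk
      have := Int.one_le_abs this
      rw [← Int.cast_abs]
      exact_mod_cast this
    rw [hexp]
    have h2 : |P.2 - K.2| * 2 ≤ (|(k : ℝ)| + 1) * τ := by nlinarith
    -- This product is the gap between the comparisons for `|k|` and for shift `1`: `(k² - 1)τ² -
    -- 2(k - 1)τs = (k - 1)τ((k + 1)τ - 2s)`, with `k`, `s` standing for the absolute values.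
    have h3 := mul_nonneg (mul_nonneg (sub_nonneg.2 h1) hτ.le) (sub_nonneg.2 h2)
    nlinarith

theorem measurable_angle (K : Sphere2) : Measurable fun Q : Sphere2 => angle (K : E3) (Q : E3) := by
  simp_rw [angle_sphere]
  exact (continuous_arccos.comp (by fun_prop)).measurable

theorem measurable_cellHeight (τ : ℝ) (K : Sphere2) : Measurable (cellHeight τ K) := by
  have h := measurable_angle K
  have h' := h.comp (continuous_sphereMap (mirror 2)).measurable
  exact measurable_const.min
    (((measurable_const.add (h'.pow_const 2)).sub (h.pow_const 2)).div_const _)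

theorem sphereMap_mirror_mirror (i : Fin 3) (Q : Sphere2) :
    sphereMap (mirror i) (sphereMap (mirror i) Q) = Q := by
  ext j
  rw [coe_sphereMap, coe_sphereMap, mirror_apply, mirror_apply]
  split_ifs <;> simp

/-- The two bisector heights add up to `τ`. If one reaches the cap `τ`, the other is nonpositive and
`ENNReal.ofReal` truncates it to `0`, so the total is unchanged. -/
theorem cellHeight_add_cellHeight {τ : ℝ} (hτ : 0 < τ) (K Q : Sphere2) :
    ENNReal.ofReal (2 * cellHeight τ K Q) + ENNReal.ofReal (2 * cellHeight τ K (sphereMap (mirror 2) Q)) =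
      ENNReal.ofReal (2 * τ) := by
  unfold cellHeight
  rw [sphereMap_mirror_mirror]
  set D := angle (K : E3) (sphereMap (mirror 2) Q) ^ 2 with hD
  set E := angle (K : E3) Q ^ 2 with hE
  have h2 : 0 < 2 * τ := by linarith
  rcases le_or_gt τ ((τ ^ 2 + D - E) / (2 * τ)) with h | h
  · rw [min_eq_left h]
    have h' := (le_div_iff₀ h2).1 h
    have : (τ ^ 2 + E - D) / (2 * τ) ≤ 0 := div_nonpos_of_nonpos_of_nonneg (by nlinarith) h2.le
    rw [ENNReal.ofReal_of_nonpos (p := 2 * min τ _) (by linarith [min_le_right τ ((τ ^ 2 + E - D) / (2 * τ))]),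
      add_zero]
  rcases le_or_gt τ ((τ ^ 2 + E - D) / (2 * τ)) with h3 | h3
  · rw [min_eq_left h3]
    have h' := (le_div_iff₀ h2).1 h3
    have : (τ ^ 2 + D - E) / (2 * τ) ≤ 0 := div_nonpos_of_nonpos_of_nonneg (by nlinarith) h2.le
    rw [ENNReal.ofReal_of_nonpos (p := 2 * min τ ((τ ^ 2 + D - E) / (2 * τ)))
      (by linarith [min_le_right τ ((τ ^ 2 + D - E) / (2 * τ))]), zero_add]
  rw [min_eq_right h.le, min_eq_right h3.le]
  have h4 := (div_lt_iff₀ h2).1 h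
  have h5 := (div_lt_iff₀ h2).1 h3
  rw [← ENNReal.ofReal_add]
  · congr 1
    field_simp
    ring
  · exact mul_nonneg (by norm_num) (div_nonneg (by nlinarith) h2.le)
  · exact mul_nonneg (by norm_num) (div_nonneg (by nlinarith) h2.le)

theorem volume_abs_sub_le (p h : ℝ) : volume {s : ℝ | |s - p| ≤ h} = ENNReal.ofReal (2 * h) := by
  have : {s : ℝ | |s - p| ≤ h} = Metric.closedBall p h := by
    ext s; rw [mem_ofPred_eq, Metric.mem_closedBall, Real.dist_eq]
  rw [this, Real.volume_closedBall]

theorem isClosed_dvCell (Γ : Subgroup Isom) (K : Space) : IsClosed (dvCell Γ K) := by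
  have : dvCell Γ K = ⋂ g ∈ Γ, {P | gdist K P ≤ gdist (act g K) P} := by
    ext P; simp [dvCell]
  rw [this]
  exact isClosed_biInter fun g _ => isClosed_le (continuous_gdist _) (continuous_gdist _)

/-- Reflection in `z = 0` preserves the integral of the fibre length. Added to its reflection, the
integrand is the constant `2τ` on a quarter of area `π`, so twice the volume is `2πτ`. -/
theorem vol_dvCell {τ : ℝ} (hτ : 0 < τ) {K : Space} (h0 : (K.1 : E3) 0 ≠ 0)
    (h1 : (K.1 : E3) 1 ≠ 0) : vol (dvCell (spaceGroup τ) K) = ENNReal.ofReal (π * τ) := by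
  set A := quarter ((K.1 : E3) 0) ((K.1 : E3) 1) with hA
  have hAm : MeasurableSet A := measurableSet_quarter _ _
  set F : Sphere2 → ℝ≥0∞ := A.indicator fun Q => ENNReal.ofReal (2 * cellHeight τ K.1 Q) with hF
  have hFm : Measurable F :=
    (((measurable_cellHeight τ K.1).const_mul 2).ennreal_ofReal).indicator hAm
  have hvol : vol (dvCell (spaceGroup τ) K) = ∫⁻ Q, F Q ∂surf := by
    rw [vol, Measure.prod_apply (isClosed_dvCell _ _).measurableSet]
    congr 1
    ext Q
    by_cases hQ : Q ∈ A
    · rw [hF, indicator_of_mem hQ, ← volume_abs_sub_le K.2]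
      congr 1
      ext s
      exact ⟨fun h => (dvCell_subset hτ h).2, fun h => mem_dvCell hτ hQ h⟩
    · rw [hF, indicator_of_notMem hQ]
      have : Prod.mk Q ⁻¹' dvCell (spaceGroup τ) K = ∅ := by
        ext s
        simp only [mem_preimage, mem_empty_iff_false, iff_false]
        exact fun h => hQ (dvCell_subset hτ h).1
      rw [this, measure_empty]
  have hinv : ∫⁻ Q, F (sphereMap (mirror 2) Q) ∂surf = ∫⁻ Q, F Q ∂surf :=
    (measurePreserving_sphereMap (mirror 2)).lintegral_comp hFm
  have hsum : ∫⁻ Q, F Q ∂surf + ∫⁻ Q, F Q ∂surf = ENNReal.ofReal (2 * (π * τ)) := by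
    conv_lhs => rw [← hinv]
    nth_rewrite 1 [hinv]
    rw [← lintegral_add_left hFm]
    have : ∀ Q, F Q + F (sphereMap (mirror 2) Q) = A.indicator (fun _ => ENNReal.ofReal (2 * τ)) Q := by
      intro Q
      have hmem : sphereMap (mirror 2) Q ∈ A ↔ Q ∈ A := by
        simp [hA, quarter, mirror_apply]
      by_cases hQ : Q ∈ A
      · rw [hF, indicator_of_mem hQ, indicator_of_mem (hmem.2 hQ), indicator_of_mem hQ,
          cellHeight_add_cellHeight hτ]
      · rw [hF, indicator_of_notMem hQ, indicator_of_notMem (fun h => hQ (hmem.1 h)),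
          indicator_of_notMem hQ, add_zero]
    simp_rw [this]
    rw [lintegral_indicator_const hAm, hA, surf_quarter h0 h1, ← ENNReal.ofReal_mul (by linarith)]
    congr 1
    ring
  rw [hvol]
  rw [← two_mul, ENNReal.ofReal_mul (by norm_num), ENNReal.ofReal_ofNat] at hsum
  exact (ENNReal.mul_right_inj (by norm_num) (by norm_num)).1 hsum

/-! ### The density formula -/

theorem Admissible.sin_le_abs_coord {τ : ℝ} {K : Space} {R : ℝ} (hR : 0 < R)
    (h : Admissible τ K R) : sin R ≤ |(K.1 : E3) 0| ∧ sin R ≤ |(K.1 : E3) 1| := by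
  have hx := arcsin_le_pi_div_two |(K.1 : E3) 0|
  have a0 := abs_coord_le_one K.1 0
  have a1 := abs_coord_le_one K.1 1
  have n0 := abs_nonneg ((K.1 : E3) 0)
  have n1 := abs_nonneg ((K.1 : E3) 1)
  exact ⟨(le_arcsin_iff_sin_le ⟨by linarith [pi_pos], h.le_zero.trans hx⟩ ⟨by linarith, a0⟩).1 h.le_zero,
    (le_arcsin_iff_sin_le ⟨by linarith [pi_pos], h.le_zero.trans hx⟩ ⟨by linarith, a1⟩).1 h.le_one⟩

/-- Unit norm gives `2 sin² R ≤ x² + y² ≤ 1`. This keeps `R` in the range where `vol_gball` applies.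
-/
theorem Admissible.le_pi_div_four {τ : ℝ} {K : Space} {R : ℝ} (hR : 0 < R)
    (h : Admissible τ K R) : R ≤ π / 4 := by
  have hx := h.le_zero.trans (arcsin_le_pi_div_two |(K.1 : E3) 0|)
  obtain ⟨h0, h1⟩ := h.sin_le_abs_coord hR
  have hs : 0 ≤ sin R := sin_nonneg_of_nonneg_of_le_pi hR.le (by linarith [pi_pos])
  have h0' := pow_le_pow_left₀ hs h0 2
  have h1' := pow_le_pow_left₀ hs h1 2
  rw [sq_abs] at h0' h1'
  have hsum := sum_sq_coords K.1
  have hc : 0 ≤ cos (2 * R) := by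
    rw [cos_two_mul, cos_sq']; nlinarith [sq_nonneg ((K.1 : E3) 2)]
  by_contra! hlt
  have := cos_neg_of_pi_div_two_lt_of_lt (x := 2 * R) (by linarith) (by linarith)
  linarith

/-- The density of a simply transitive ball packing. -/
theorem density_eq {τ : ℝ} (hτ : 0 < τ) {K : Space} {R : ℝ}
    (h0 : (K.1 : E3) 0 ≠ 0) (h1 : (K.1 : E3) 1 ≠ 0) (hR : 0 < R) (h : Admissible τ K R) :
    density (spaceGroup τ) K R = 2 * R * ballProfile R / τ := by
  have hball : ballUnion (spaceGroup τ) K R ∩ dvCell (spaceGroup τ) K = gball K R := by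
    ext P
    constructor
    · rintro ⟨hP, hcell⟩
      rw [ballUnion, mem_iUnion₂] at hP
      obtain ⟨g, hg, hP⟩ := hP
      exact (hcell g hg).trans hP
    · intro hP
      refine ⟨mem_iUnion₂.2 ⟨1, one_mem _, hP⟩, fun g hg => ?_⟩
      by_cases hne : act g K = K
      · rw [hne]
      · have h2 := h.two_mul_le_gdist hR hg hne
        have h3 := gdist_triangle K P (act g K)
        rw [gdist_comm P] at h3
        have hP : gdist K P ≤ R := hP
        linarith
  have hpr : 0 ≤ ballProfile R := by
    apply intervalIntegral.integral_nonneg (by norm_num)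
    intro u _
    linarith [cos_le_one (R * √(1 - u ^ 2))]
  rw [density, hball, measureReal_def, measureReal_def, vol_dvCell hτ h0 h1,
    vol_gball K hR (by linarith [h.le_pi_div_four hR, pi_pos]),
    ENNReal.toReal_ofReal (by positivity), ENNReal.toReal_ofReal (by positivity)]
  field_simp

/-! ### Alternating Taylor bounds -/

/-- Taylor polynomials of the cosine. -/
def cosTaylor (n : ℕ) (x : ℝ) : ℝ := ∑ k ∈ Finset.range n, (-1) ^ k * x ^ (2 * k) / (2 * k).factorial

/-- Taylor polynomials of the sine. -/
def sinTaylor (n : ℕ) (x : ℝ) : ℝ :=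
  ∑ k ∈ Finset.range n, (-1) ^ k * x ^ (2 * k + 1) / (2 * k + 1).factorial

theorem hasDerivAt_sinTaylor (n : ℕ) (x : ℝ) : HasDerivAt (sinTaylor n) (cosTaylor n x) x := by
  unfold sinTaylor cosTaylor
  apply HasDerivAt.fun_sum
  intro k _
  have h := ((hasDerivAt_pow (2 * k + 1) x).const_mul ((-1 : ℝ) ^ k)).div_const
    ((2 * k + 1).factorial : ℝ)
  refine h.congr_deriv ?_
  rw [Nat.factorial_succ, Nat.add_sub_cancel]
  push_cast
  have : ((2 * k).factorial : ℝ) ≠ 0 := by positivity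
  field_simp

theorem hasDerivAt_cosTaylor (n : ℕ) (x : ℝ) :
    HasDerivAt (cosTaylor (n + 1)) (-sinTaylor n x) x := by
  have heq : cosTaylor (n + 1) = fun x => (∑ k ∈ Finset.range n,
      (-1) ^ (k + 1) * x ^ (2 * (k + 1)) / ((2 * (k + 1)).factorial : ℝ)) + 1 := by
    ext y
    rw [cosTaylor, Finset.sum_range_succ']
    simp
  rw [heq]
  apply HasDerivAt.add_const
  rw [sinTaylor, ← Finset.sum_neg_distrib]
  apply HasDerivAt.fun_sum
  intro k _
  have h := ((hasDerivAt_pow (2 * (k + 1)) x).const_mul ((-1 : ℝ) ^ (k + 1))).div_const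
    ((2 * (k + 1)).factorial : ℝ)
  refine h.congr_deriv ?_
  rw [show 2 * (k + 1) = (2 * k + 1) + 1 by ring, Nat.factorial_succ, Nat.add_sub_cancel]
  push_cast
  have : ((2 * k + 1).factorial : ℝ) ≠ 0 := by positivity
  field_simp
  ring

theorem nonneg_of_hasDerivAt_nonneg {f f' : ℝ → ℝ} (hf : ∀ x, HasDerivAt f (f' x) x)
    (h0 : f 0 = 0) (h : ∀ x, 0 ≤ x → 0 ≤ f' x) {x : ℝ} (hx : 0 ≤ x) : 0 ≤ f x := by
  have hmono : MonotoneOn f (Ici 0) := by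
    apply monotoneOn_of_hasDerivWithinAt_nonneg (convex_Ici 0)
      (fun x _ => (hf x).continuousAt.continuousWithinAt) (fun x _ => (hf x).hasDerivWithinAt)
    intro x hx
    rw [interior_Ici] at hx
    exact h x hx.le
  rw [← h0]
  exact hmono (by simp) hx hx

/-- Each remainder vanishes at `0` and its derivative is, up to sign, the preceding one, so the
signs propagate by monotonicity from `cos x ≤ 1`. The index counts terms: an odd number bounds from
above, an even one from below. -/
theorem taylor_alternating (n : ℕ) :
    (∀ x : ℝ, 0 ≤ x → 0 ≤ (-1) ^ (n + 1) * (cos x - cosTaylor (n + 1) x)) ∧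
    (∀ x : ℝ, 0 ≤ x → 0 ≤ (-1) ^ (n + 1) * (sin x - sinTaylor (n + 1) x)) := by
  have hsin : ∀ m : ℕ, (∀ x : ℝ, 0 ≤ x → 0 ≤ (-1) ^ m * (cos x - cosTaylor m x)) →
      ∀ x : ℝ, 0 ≤ x → 0 ≤ (-1) ^ m * (sin x - sinTaylor m x) := by
    intro m h x hx
    exact nonneg_of_hasDerivAt_nonneg (f := fun x => (-1) ^ m * (sin x - sinTaylor m x))
      (fun x => ((hasDerivAt_sin x).sub (hasDerivAt_sinTaylor m x)).const_mul _)
      (by simp [sinTaylor]) h hx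
  induction n with
  | zero =>
    have h : ∀ x : ℝ, 0 ≤ x → 0 ≤ (-1) ^ (0 + 1) * (cos x - cosTaylor (0 + 1) x) := by
      intro x _
      simp [cosTaylor, cos_le_one]
    exact ⟨h, hsin _ h⟩
  | succ n ih =>
    have h : ∀ x : ℝ, 0 ≤ x → 0 ≤ (-1) ^ (n + 1 + 1) * (cos x - cosTaylor (n + 1 + 1) x) := by
      intro x hx
      refine nonneg_of_hasDerivAt_nonneg
        (f := fun x => (-1) ^ (n + 1 + 1) * (cos x - cosTaylor (n + 1 + 1) x))
        (fun x => ((hasDerivAt_cos x).sub (hasDerivAt_cosTaylor (n + 1) x)).const_mul _)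
        ?_ ?_ hx
      · simp [cosTaylor, Finset.sum_range_succ']
      · intro x hx
        have := ih.2 x hx
        rw [pow_succ]
        linarith
    exact ⟨h, hsin _ h⟩

theorem cos_le_cosTaylor {n : ℕ} (hn : Odd n) {x : ℝ} (hx : 0 ≤ x) : cos x ≤ cosTaylor n x := by
  obtain ⟨m, rfl⟩ := hn
  have h := (taylor_alternating (2 * m)).1 x hx
  rw [Odd.neg_one_pow ⟨m, rfl⟩] at h
  linarith

theorem cosTaylor_le_cos {n : ℕ} (hn : Even n) (h0 : n ≠ 0) {x : ℝ} (hx : 0 ≤ x) :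
    cosTaylor n x ≤ cos x := by
  obtain ⟨m, rfl⟩ := Nat.exists_eq_succ_of_ne_zero h0
  have h := (taylor_alternating m).1 x hx
  rw [Even.neg_one_pow hn] at h
  linarith

/-! ### Moments and Taylor bounds for the ball profile -/

/-- The moments of the polynomial `1 - u ^ 2`. -/
def moment (k : ℕ) : ℝ := ∫ u in (-1 : ℝ)..1, (1 - u ^ 2) ^ k

theorem moment_zero : moment 0 = 2 := by norm_num [moment]

/-- Integrate the derivative of `u * (1 - u ^ 2) ^ (k + 1)`, which vanishes at both ends. -/
theorem moment_succ (k : ℕ) : moment (k + 1) = (2 * k + 2) / (2 * k + 3) * moment k := by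
  have hd : ∀ u ∈ uIcc (-1 : ℝ) 1, HasDerivAt (fun u : ℝ => u * (1 - u ^ 2) ^ (k + 1))
      ((2 * k + 3) * (1 - u ^ 2) ^ (k + 1) - (2 * k + 2) * (1 - u ^ 2) ^ k) u := by
    intro u _
    have h1 : HasDerivAt (fun u : ℝ => 1 - u ^ 2) (-(2 * u)) u := by
      simpa using (hasDerivAt_pow 2 u).const_sub 1
    refine ((hasDerivAt_id' u).fun_mul (h1.fun_pow (k + 1))).congr_deriv ?_
    rw [Nat.add_sub_cancel]
    push_cast
    ring
  have h := intervalIntegral.integral_eq_sub_of_hasDerivAt hd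
    (Continuous.intervalIntegrable (by fun_prop) _ _)
  rw [intervalIntegral.integral_sub (Continuous.intervalIntegrable (by fun_prop) _ _)
    (Continuous.intervalIntegrable (by fun_prop) _ _), intervalIntegral.integral_const_mul,
    intervalIntegral.integral_const_mul] at h
  norm_num at h
  have h' : (2 * (k : ℝ) + 3) * moment (k + 1) - (2 * k + 2) * moment k = 0 := h
  have : (2 * (k : ℝ) + 3) ≠ 0 := by positivity
  field_simp
  linarith

/-- Taylor polynomials of `ballProfile`. -/
def profileTaylor (n : ℕ) (R : ℝ) : ℝ :=
  2 - ∑ k ∈ Finset.range n, (-1) ^ k * R ^ (2 * k) / (2 * k).factorial * moment k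

/-- Only even powers of the square root occur, so the integrand is a polynomial in `u` on `[-1, 1]`.
-/
theorem integral_one_sub_cosTaylor (n : ℕ) (R : ℝ) :
    ∫ u in (-1 : ℝ)..1, (1 - cosTaylor n (R * √(1 - u ^ 2))) = profileTaylor n R := by
  have h : EqOn (fun u : ℝ => 1 - cosTaylor n (R * √(1 - u ^ 2))) (fun u => 1 - ∑ k ∈ Finset.range n,
      (-1) ^ k * R ^ (2 * k) / (2 * k).factorial * (1 - u ^ 2) ^ k) (uIcc (-1) 1) := by
    intro u hu
    rw [uIcc_of_le (by norm_num)] at hu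
    have hu2 : 0 ≤ 1 - u ^ 2 := by nlinarith [hu.1, hu.2]
    simp only [cosTaylor]
    congr 1
    apply Finset.sum_congr rfl
    intro k _
    rw [mul_pow, pow_mul √(1 - u ^ 2), sq_sqrt hu2]
    ring
  rw [intervalIntegral.integral_congr h, intervalIntegral.integral_sub
    (Continuous.intervalIntegrable (by fun_prop) _ _)
    (Continuous.intervalIntegrable (by fun_prop) _ _), intervalIntegral.integral_finsetSum
    (fun k _ => Continuous.intervalIntegrable (by fun_prop) _ _)]
  simp_rw [intervalIntegral.integral_const_mul]
  rw [profileTaylor]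
  norm_num [moment]

theorem continuous_cosTaylor (n : ℕ) : Continuous (cosTaylor n) := by
  unfold cosTaylor; fun_prop

theorem profileTaylor_le {n : ℕ} (hn : Odd n) {R : ℝ} (hR : 0 ≤ R) :
    profileTaylor n R ≤ ballProfile R := by
  rw [← integral_one_sub_cosTaylor, ballProfile]
  have := continuous_cosTaylor n
  apply intervalIntegral.integral_mono_on (by norm_num)
    (Continuous.intervalIntegrable (by fun_prop) _ _)
    (Continuous.intervalIntegrable (by fun_prop) _ _)
  intro u _
  linarith [cos_le_cosTaylor hn (mul_nonneg hR (sqrt_nonneg (1 - u ^ 2)))]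

theorem le_profileTaylor {n : ℕ} (hn : Even n) (h0 : n ≠ 0) {R : ℝ} (hR : 0 ≤ R) :
    ballProfile R ≤ profileTaylor n R := by
  rw [← integral_one_sub_cosTaylor, ballProfile]
  have := continuous_cosTaylor n
  apply intervalIntegral.integral_mono_on (by norm_num)
    (Continuous.intervalIntegrable (by fun_prop) _ _)
    (Continuous.intervalIntegrable (by fun_prop) _ _)
  intro u _
  linarith [cosTaylor_le_cos hn h0 (mul_nonneg hR (sqrt_nonneg (1 - u ^ 2)))]

/-! ### Growth of the ball profile -/

theorem sqrt_one_sub_sq_mem {u : ℝ} : √(1 - u ^ 2) ∈ Icc (0 : ℝ) 1 :=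
  ⟨sqrt_nonneg _, sqrt_le_one.2 (by nlinarith [sq_nonneg u])⟩

theorem ballProfile_strictMonoOn : StrictMonoOn ballProfile (Icc 0 π) := by
  intro R hR R' hR' hlt
  apply intervalIntegral.integral_lt_integral_of_continuousOn_of_le_of_exists_lt (by norm_num)
    (Continuous.continuousOn (by fun_prop)) (Continuous.continuousOn (by fun_prop))
  · intro u _
    obtain ⟨h0, h1⟩ := sqrt_one_sub_sq_mem (u := u)
    have hle : R * √(1 - u ^ 2) ≤ R' * √(1 - u ^ 2) := by gcongr
    have h2 : R' * √(1 - u ^ 2) ≤ R' := mul_le_of_le_one_right hR'.1 h1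
    linarith [cos_le_cos_of_nonneg_of_le_pi (mul_nonneg hR.1 h0) (h2.trans hR'.2) hle]
  · refine ⟨0, by norm_num, ?_⟩
    have := cos_lt_cos_of_nonneg_of_le_pi hR.1 hR'.2 hlt
    simpa using this

/-- Since `1 - cos x = 2 sin² (x / 2)` and `sin` is concave with `sin 0 = 0`, the quotient `(1 - cos
x) / x²` does not increase. -/
theorem one_sub_cos_mul_sq_le {x y : ℝ} (hx : 0 ≤ x) (hxy : x ≤ y) (hy : y ≤ π) :
    (1 - cos y) * x ^ 2 ≤ (1 - cos x) * y ^ 2 := by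
  have hhalf : ∀ z, 1 - cos z = 2 * sin (z / 2) ^ 2 := by
    intro z
    conv_lhs => rw [show z = 2 * (z / 2) by ring, cos_two_mul, cos_sq']
    ring
  have hc := strictConcaveOn_sin_Icc.concaveOn
  rcases hx.eq_or_lt with rfl | hx0
  · simp
  have hy0 : 0 < y := hx0.trans_le hxy
  have h := hc.2 (show (0 : ℝ) ∈ Icc 0 π from ⟨le_rfl, pi_pos.le⟩)
    (show y / 2 ∈ Icc 0 π from ⟨by linarith, by linarith⟩)
    (sub_nonneg.2 ((div_le_one hy0).2 hxy)) (by positivity : 0 ≤ x / y) (by ring)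
  simp only [smul_eq_mul, sin_zero, mul_zero, zero_add] at h
  rw [show x / y * (y / 2) = x / 2 by field_simp] at h
  have h2 : x * sin (y / 2) ≤ y * sin (x / 2) := by
    rw [div_mul_eq_mul_div, div_le_iff₀ hy0] at h
    linarith
  have h3 : 0 ≤ sin (y / 2) := sin_nonneg_of_nonneg_of_le_pi (by linarith) (by linarith)
  have h4 := pow_le_pow_left₀ (mul_nonneg hx h3) h2 2
  rw [hhalf, hhalf]
  nlinarith

/-- The profile grows at most quadratically. This reduces the comparison of densities for large
radii to an inequality between powers of `R`, `R₁` and `τ`. -/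
theorem ballProfile_mul_sq_le {R R' : ℝ} (hR : 0 ≤ R) (hle : R ≤ R') (hR' : R' ≤ π) :
    ballProfile R' * R ^ 2 ≤ ballProfile R * R' ^ 2 := by
  rw [ballProfile, ballProfile, ← intervalIntegral.integral_mul_const,
    ← intervalIntegral.integral_mul_const]
  apply intervalIntegral.integral_mono_on (by norm_num)
    (Continuous.intervalIntegrable (by fun_prop) _ _)
    (Continuous.intervalIntegrable (by fun_prop) _ _)
  intro u _
  obtain ⟨h0, h1⟩ := sqrt_one_sub_sq_mem (u := u)
  set w := √(1 - u ^ 2)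
  rcases h0.eq_or_lt with hw | hw
  · rw [← hw]; simp
  have hR'0 : 0 ≤ R' := hR.trans hle
  have h := one_sub_cos_mul_sq_le (mul_nonneg hR h0) (mul_le_mul_of_nonneg_right hle h0)
    ((mul_le_of_le_one_right hR'0 h1).trans hR')
  have hw2 : 0 < w ^ 2 := by positivity
  apply le_of_mul_le_mul_right _ hw2
  linarith [h, mul_pow R w 2, mul_pow R' w 2,
    (by ring : (1 - cos (R' * w)) * R ^ 2 * w ^ 2 = (1 - cos (R' * w)) * (R * w) ^ 2),
    (by ring : (1 - cos (R * w)) * R' ^ 2 * w ^ 2 = (1 - cos (R * w)) * (R' * w) ^ 2)]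

theorem ballProfile_pos {R : ℝ} (hR : 0 < R) (hR' : R ≤ π) : 0 < ballProfile R := by
  have h := ballProfile_strictMonoOn ⟨le_rfl, pi_pos.le⟩ ⟨hR.le, hR'⟩ hR
  have h0 : ballProfile 0 = 0 := by simp [ballProfile]
  rwa [h0] at h

/-! ### The touching equation and its root -/

/-- The radius `R` of the optimal arrangement solves `touchEq R = 1`. -/
def touchEq (R : ℝ) : ℝ := 2 * sin R ^ 2 + sin (√3 / 2 * R) ^ 2

theorem sqrt_three_bounds : 1.73205080756 < √3 ∧ √3 < 1.73205080757 := by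
  constructor
  · apply Real.lt_sqrt_of_sq_lt; norm_num
  · rw [Real.sqrt_lt' (by norm_num)]; norm_num

theorem touchEq_strictMonoOn : StrictMonoOn touchEq (Icc 0 (π / 2)) := by
  intro R hR R' hR' hlt
  obtain ⟨h1, h2⟩ := sqrt_three_bounds
  have hpos : 0 < √3 / 2 := by positivity
  have hs : sin R < sin R' := sin_lt_sin_of_lt_of_le_pi_div_two (by linarith [hR.1, pi_pos]) hR'.2 hlt
  have hs0 : 0 ≤ sin R := sin_nonneg_of_nonneg_of_le_pi hR.1 (by linarith [hR.2, pi_pos])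
  have hle : √3 / 2 * R' ≤ R' := mul_le_of_le_one_left (hR.1.trans hlt.le) (by linarith)
  have hle' : √3 / 2 * R ≤ R := mul_le_of_le_one_left hR.1 (by linarith)
  have hn : 0 ≤ √3 / 2 * R := mul_nonneg hpos.le hR.1
  have ht : sin (√3 / 2 * R) < sin (√3 / 2 * R') := sin_lt_sin_of_lt_of_le_pi_div_two
    (by linarith [pi_pos]) (hle.trans hR'.2) (by gcongr)
  have ht0 : 0 ≤ sin (√3 / 2 * R) :=
    sin_nonneg_of_nonneg_of_le_pi hn (by linarith [hR.2, pi_pos])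
  have := pow_lt_pow_left₀ hs hs0 two_ne_zero
  have := pow_lt_pow_left₀ ht ht0 two_ne_zero
  unfold touchEq
  linarith

theorem touchEq_eq (R : ℝ) : touchEq R = 3 / 2 - cos (2 * R) - cos (√3 * R) / 2 := by
  rw [touchEq, show √3 * R = 2 * (√3 / 2 * R) by ring, cos_two_mul, cos_two_mul, cos_sq', cos_sq']
  ring

theorem cosTaylor_sqrt_three_mul (n : ℕ) (R : ℝ) : cosTaylor n (√3 * R) =
    ∑ k ∈ Finset.range n, (-1) ^ k * (3 * R ^ 2) ^ k / (2 * k).factorial := by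
  rw [cosTaylor]
  apply Finset.sum_congr rfl
  intro k _
  rw [pow_mul, mul_pow, sq_sqrt (by norm_num)]

theorem exists_touchEq_eq_one : ∃ R : ℝ, 0.6436044631 < R ∧ R < 0.6436044633 ∧ touchEq R = 1 := by
  have hcont : Continuous touchEq := by unfold touchEq; fun_prop
  have hlo : touchEq 0.6436044631 < 1 := by
    -- By `touchEq_eq`, lower bounds for the cosines (eight terms) bound `touchEq` from above; nine
    -- terms do the reverse at the other endpoint.
    have h1 := cosTaylor_le_cos (n := 8) (by decide) (by norm_num) (x := 2 * 0.6436044631) (by norm_num)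
    have h2 := cosTaylor_le_cos (n := 8) (by decide) (by norm_num) (x := √3 * 0.6436044631)
      (by positivity)
    rw [cosTaylor_sqrt_three_mul] at h2
    norm_num [cosTaylor, Finset.sum_range_succ, Nat.factorial] at h1 h2
    rw [touchEq_eq]
    norm_num
    linarith
  have hhi : 1 < touchEq 0.6436044633 := by
    have h1 := cos_le_cosTaylor (n := 9) (by decide) (x := 2 * 0.6436044633) (by norm_num)
    have h2 := cos_le_cosTaylor (n := 9) (by decide) (x := √3 * 0.6436044633)
      (by positivity)
    rw [cosTaylor_sqrt_three_mul] at h2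
    norm_num [cosTaylor, Finset.sum_range_succ, Nat.factorial] at h1 h2
    rw [touchEq_eq]
    norm_num
    linarith
  obtain ⟨R, hR, h⟩ := intermediate_value_Ioo (by norm_num : (0.6436044631 : ℝ) ≤ 0.6436044633)
    hcont.continuousOn ⟨hlo, hhi⟩
  exact ⟨R, hR.1, hR.2, h⟩

theorem ballProfile_bounds {R : ℝ} (h1 : 0.6436044631 < R) (h2 : R < 0.6436044633) :
    0.268614853 < ballProfile R ∧ ballProfile R < 0.268614855 := by
  have hπ := pi_gt_three
  constructor
  · refine lt_of_lt_of_le ?_ ((profileTaylor_le (n := 7) (by decide)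
      (by norm_num : (0 : ℝ) ≤ 0.6436044631)).trans (ballProfile_strictMonoOn.monotoneOn
        ⟨by norm_num, by linarith⟩ ⟨by linarith, by linarith⟩ h1.le))
    norm_num [profileTaylor, Finset.sum_range_succ, Nat.factorial, moment_succ, moment_zero]
  · refine lt_of_le_of_lt ((ballProfile_strictMonoOn.monotoneOn
        ⟨by linarith, by linarith⟩ ⟨by norm_num, by linarith⟩ h2.le).trans
        (le_profileTaylor (n := 6) (by decide) (by norm_num)
      (by norm_num : (0 : ℝ) ≤ 0.6436044633))) ?_
    norm_num [profileTaylor, Finset.sum_range_succ, Nat.factorial, moment_succ, moment_zero]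

/-! ### The touching arrangement -/

theorem gdist_act_g₁ (P : Sphere2) (p : ℝ) :
    gdist (P, p) (act g₁ (P, p)) = 2 * arcsin |(P : E3) 0| := by
  have hs := isSigned_g₁ 0
  have h0 := arcsin_nonneg.2 (abs_nonneg ((P : E3) 0))
  rw [gdist, act_snd hs, angle_sphere, real_inner_comm, inner_act hs,
    ← Real.sqrt_sq (by linarith : 0 ≤ 2 * arcsin |(P : E3) 0|),
    ← arccos_one_sub_two_mul_sq (abs_nonneg _) (abs_coord_le_one _ _), sq_abs]
  congr 1
  have : -1 * ((P : E3) 0 * (P : E3) 0) + 1 * ((P : E3) 1 * (P : E3) 1) +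
      (-1) ^ (0 : ℤ) * ((P : E3) 2 * (P : E3) 2) = 1 - 2 * (P : E3) 0 ^ 2 := by
    rw [zpow_zero]; linarith [sum_sq_coords P]
  simp only [this]
  push_cast
  ring

theorem gdist_act_g₂ (P : Sphere2) (p : ℝ) :
    gdist (P, p) (act g₂ (P, p)) = 2 * arcsin |(P : E3) 1| := by
  have hs := isSigned_g₂ 0
  have h0 := arcsin_nonneg.2 (abs_nonneg ((P : E3) 1))
  rw [gdist, act_snd hs, angle_sphere, real_inner_comm, inner_act hs,
    ← Real.sqrt_sq (by linarith : 0 ≤ 2 * arcsin |(P : E3) 1|),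
    ← arccos_one_sub_two_mul_sq (abs_nonneg _) (abs_coord_le_one _ _), sq_abs]
  congr 1
  have : 1 * ((P : E3) 0 * (P : E3) 0) + -1 * ((P : E3) 1 * (P : E3) 1) +
      (-1) ^ (0 : ℤ) * ((P : E3) 2 * (P : E3) 2) = 1 - 2 * (P : E3) 1 ^ 2 := by
    rw [zpow_zero]; linarith [sum_sq_coords P]
  simp only [this]
  push_cast
  ring

theorem gdist_act_τg₃ (τ : ℝ) (P : Sphere2) (p : ℝ) :
    gdist (P, p) (act (τg₃ τ) (P, p)) = √((2 * arcsin |(P : E3) 2|) ^ 2 + τ ^ 2) := by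
  have hs := isSigned_τg₃ τ
  rw [gdist, act_snd hs, angle_sphere, real_inner_comm, inner_act hs,
    ← arccos_one_sub_two_mul_sq (abs_nonneg _) (abs_coord_le_one _ _), sq_abs]
  congr 1
  have : 1 * ((P : E3) 0 * (P : E3) 0) + 1 * ((P : E3) 1 * (P : E3) 1) +
      (-1) ^ (1 : ℤ) * ((P : E3) 2 * (P : E3) 2) = 1 - 2 * (P : E3) 2 ^ 2 := by
    rw [zpow_one]; linarith [sum_sq_coords P]
  simp only [this]
  push_cast
  ring

theorem gdist_act_fibreTranslation {τ : ℝ} (hτ : 0 ≤ τ) (K : Space) :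
    gdist K (act (fibreTranslation (2 * τ)) K) = 2 * τ := by
  have hs := isSigned_fibreTranslation τ
  rw [gdist, act_snd hs]
  rw [show ((act (fibreTranslation (2 * τ)) K).1 : E3) = K.1 from rfl,
    InnerProductGeometry.angle_self (by rw [← norm_ne_zero_iff, norm_coe_sphere]; norm_num)]
  rw [← Real.sqrt_sq (by linarith : 0 ≤ 2 * τ)]
  congr 1
  push_cast
  ring

theorem τg₃_mul_self (τ : ℝ) : τg₃ τ * τg₃ τ = fibreTranslation (2 * τ) := by
  have h : IsSigned τ (τg₃ τ * τg₃ τ) 1 1 2 := by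
    simpa using (isSigned_τg₃ τ).mul (isSigned_τg₃ τ)
  exact h.eq (isSigned_fibreTranslation τ)

/-- The kernel point of the arrangement in which the ball of radius `R` touches its neighbours. -/
theorem geoPoint_coords {R : ℝ} (h1 : 0.6436044631 < R) (h2 : R < 0.6436044633)
    (h : touchEq R = 1) : (geoPoint (π / 4) (√3 / 2 * R) : E3) 0 = sin R ∧
      (geoPoint (π / 4) (√3 / 2 * R) : E3) 1 = sin R ∧
      (geoPoint (π / 4) (√3 / 2 * R) : E3) 2 = sin (√3 / 2 * R) := by
  obtain ⟨hs1, hs2⟩ := sqrt_three_bounds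
  have hπ := pi_gt_three
  have hθ0 : 0 ≤ √3 / 2 * R := by positivity
  have hθ1 : √3 / 2 * R ≤ 1 := by nlinarith
  have hc : 0 ≤ cos (√3 / 2 * R) := cos_nonneg_of_mem_Icc ⟨by linarith, by linarith⟩
  have hs : 0 ≤ sin R := sin_nonneg_of_nonneg_of_le_pi (by linarith) (by linarith)
  have hkey : √2 / 2 * cos (√3 / 2 * R) = sin R := by
    rw [← pow_left_inj₀ (by positivity) hs two_ne_zero, mul_pow, cos_sq', div_pow, sq_sqrt (by norm_num)]
    unfold touchEq at h
    linarith
  refine ⟨?_, ?_, ?_⟩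
  · rw [← hkey, ← cos_pi_div_four]; rfl
  · rw [← hkey, ← sin_pi_div_four]; rfl
  · rfl

theorem sphere_ext {P Q : Sphere2} (h0 : (P : E3) 0 = (Q : E3) 0) (h1 : (P : E3) 1 = (Q : E3) 1)
    (h2 : (P : E3) 2 = (Q : E3) 2) : P = Q := by
  ext i
  fin_cases i
  · exact h0
  · exact h1
  · exact h2

/-- The translation gives `τ = R`, the mirrors give `arcsin x = arcsin y = R`, and the glide gives
`4 arcsin² z = 4R² - R²`. Unit norm then becomes `touchEq R = 1`; the three other requirements
follow from these. -/
theorem isFirstArrangement_iff {R₁ : ℝ} (h1 : 0.6436044631 < R₁) (h2 : R₁ < 0.6436044633)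
    (h : touchEq R₁ = 1) {τ R : ℝ} {P : Sphere2} (hτ : 0 < τ) (hP : P ∈ triangleInterior) :
    IsFirstArrangement τ (P, 0) R ↔
      τ = R₁ ∧ R = R₁ ∧ P = geoPoint (π / 4) (√3 / 2 * R₁) := by
  obtain ⟨hc0, hc1, hc2⟩ := geoPoint_coords h1 h2 h
  obtain ⟨hs1, hs2⟩ := sqrt_three_bounds
  have hπ := pi_gt_three
  have hs3 : √3 ^ 2 = 3 := sq_sqrt (by norm_num)
  have b0 := abs_le.1 (abs_coord_le_one P 0)
  have b1 := abs_le.1 (abs_coord_le_one P 1)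
  have b2 := abs_le.1 (abs_coord_le_one P 2)
  constructor
  · rintro ⟨t1, t2, t3, -, -, -, t4⟩
    rw [gdist_act_g₁, abs_of_pos (hP 0)] at t1
    rw [gdist_act_g₂, abs_of_pos (hP 1)] at t2
    rw [gdist_act_fibreTranslation hτ.le] at t4
    obtain rfl : τ = R := by linarith
    have t1 : arcsin ((P : E3) 0) = τ := by linarith
    have t2 : arcsin ((P : E3) 1) = τ := by linarith
    have hz := arcsin_nonneg.2 (hP 2).le
    rw [gdist_act_τg₃, abs_of_pos (hP 2), Real.sqrt_eq_iff_eq_sq (by positivity) (by positivity)] at t3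
    have t3 : arcsin ((P : E3) 2) = √3 / 2 * τ := by
      rw [← pow_left_inj₀ hz (by positivity) two_ne_zero, mul_pow, div_pow, hs3]
      linarith
    have e0 : (P : E3) 0 = sin τ := by rw [← t1, sin_arcsin b0.1 b0.2]
    have e1 : (P : E3) 1 = sin τ := by rw [← t2, sin_arcsin b1.1 b1.2]
    have e2 : (P : E3) 2 = sin (√3 / 2 * τ) := by rw [← t3, sin_arcsin b2.1 b2.2]
    have hsum := sum_sq_coords P
    have heq : touchEq τ = touchEq R₁ := by
      rw [e0, e1, e2] at hsum
      rw [h, touchEq]; linarith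
    have := arcsin_le_pi_div_two ((P : E3) 0)
    have hτR : τ = R₁ := touchEq_strictMonoOn.injOn ⟨hτ.le, by linarith⟩
      ⟨by linarith, by linarith⟩ heq
    subst hτR
    exact ⟨rfl, rfl, sphere_ext (e0.trans hc0.symm) (e1.trans hc1.symm) (e2.trans hc2.symm)⟩
  · rintro ⟨hτR, hRR, hPP⟩
    have hs : arcsin |sin R₁| = R₁ := by
      rw [abs_of_nonneg (sin_nonneg_of_nonneg_of_le_pi (by linarith) (by linarith)),
        arcsin_sin (by linarith) (by linarith)]
    have hθ : arcsin |sin (√3 / 2 * R₁)| = √3 / 2 * R₁ := by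
      rw [abs_of_nonneg (sin_nonneg_of_nonneg_of_le_pi (by positivity) (by nlinarith)),
        arcsin_sin (by nlinarith) (by nlinarith)]
    rw [hτR] at hτ
    rw [hτR, hRR, hPP]
    constructor
    · rw [gdist_act_g₁, hc0, hs]
    · rw [gdist_act_g₂, hc1, hs]
    · rw [gdist_act_τg₃, hc2, hθ, Real.sqrt_eq_iff_eq_sq (by positivity) (by positivity)]
      rw [mul_pow, mul_pow, div_pow, hs3]
      ring
    · rw [τg₃_mul_self, gdist_act_fibreTranslation hτ.le]
    · rw [τg₃_mul_self]
    · rw [gdist_act_fibreTranslation hτ.le]; linarith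
    · rw [gdist_act_fibreTranslation hτ.le]

theorem admissible_optimal {R : ℝ} (h1 : 0.6436044631 < R) (h2 : R < 0.6436044633)
    (h : touchEq R = 1) : Admissible R (geoPoint (π / 4) (√3 / 2 * R), 0) R := by
  obtain ⟨hc0, hc1, hc2⟩ := geoPoint_coords h1 h2 h
  obtain ⟨hs1, hs2⟩ := sqrt_three_bounds
  have hπ := pi_gt_three
  have hs3 : √3 ^ 2 = 3 := sq_sqrt (by norm_num)
  have hs : arcsin |sin R| = R := by
    rw [abs_of_nonneg (sin_nonneg_of_nonneg_of_le_pi (by linarith) (by linarith)),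
      arcsin_sin (by linarith) (by linarith)]
  have hθ : arcsin |sin (√3 / 2 * R)| = √3 / 2 * R := by
    rw [abs_of_nonneg (sin_nonneg_of_nonneg_of_le_pi (by positivity) (by nlinarith)),
      arcsin_sin (by nlinarith) (by nlinarith)]
  refine ⟨?_, ?_, ?_, le_rfl⟩
  · rw [hc0, hs]
  · rw [hc1, hs]
  · rw [hc2, hθ, mul_pow, div_pow, hs3]; linarith

/-! ### Optimality and uniqueness -/

theorem Admissible.coord_two_sq_le {τ : ℝ} {K : Space} {R : ℝ} (hR : 0 < R)
    (h : Admissible τ K R) : (K.1 : E3) 2 ^ 2 ≤ cos (2 * R) := by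
  obtain ⟨h0, h1⟩ := h.sin_le_abs_coord hR
  have hs : 0 ≤ sin R := sin_nonneg_of_nonneg_of_le_pi hR.le
    (by linarith [h.le_pi_div_four hR, pi_pos])
  have h0' := pow_le_pow_left₀ hs h0 2
  have h1' := pow_le_pow_left₀ hs h1 2
  rw [sq_abs] at h0' h1'
  rw [cos_two_mul, cos_sq']
  linarith [sum_sq_coords K.1]

theorem arcsin_abs_le {z c : ℝ} (hz : z ^ 2 ≤ sin c ^ 2) (h0 : 0 ≤ c) (h1 : c < π / 2) :
    arcsin |z| ≤ c := by
  have hs : 0 ≤ sin c := sin_nonneg_of_nonneg_of_le_pi h0 (by linarith)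
  rw [arcsin_le_iff_le_sin' ⟨by linarith, by linarith⟩]
  exact abs_le_of_sq_le_sq hz hs

/-- Applied with `r = R₁²`, `s = R²`. The difference factors as `(s - r)(3r² - sr - s²)`, and the
second factor stays positive up to `s / r = (√13 - 1) / 2`, just above `1.3`. -/
theorem cube_lt_of_le_mul {r s : ℝ} (hr : 0 < r) (hrs : r < s) (hs : s ≤ 1.3 * r) :
    s ^ 3 < (4 * s - 3 * r) * r ^ 2 := by
  have hq : 0 < 3 * r ^ 2 - s * r - s ^ 2 := by
    have h1 : 0 ≤ (1.3 * r - s) * (2.3 * r + s) :=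
      mul_nonneg (sub_nonneg.2 hs) (by linarith)
    have h2 : 0 < r ^ 2 := by positivity
    linarith [(by ring : (1.3 * r - s) * (2.3 * r + s) = 2.99 * r ^ 2 - s * r - s ^ 2)]
  have h := mul_pos (sub_pos.2 hrs) hq
  linarith [(by ring : (s - r) * (3 * r ^ 2 - s * r - s ^ 2) = (4 * s - 3 * r) * r ^ 2 - s ^ 3)]

/-- Applied with `s = R²` in the remaining range: `0.5329 = 0.73²`, `0.6169` exceeds `(π / 4)²`,
`0.5476 = 4 · 0.37²`, and `0.171` is below `R₁⁴`. -/
theorem cube_lt_of_mem_Ioo {s : ℝ} (h1 : 0.5329 < s) (h2 : s < 0.6169) :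
    s ^ 3 < (4 * s - 0.5476) * 0.171 := by
  have h3 : s * s ≤ 0.6169 * 0.6169 := by gcongr
  have h4 : s * s * s ≤ 0.6169 * 0.6169 * s := by gcongr
  linarith [(by ring : s ^ 3 = s * s * s)]

/-- Arrangements of balls which are larger than in the optimal one have a smaller density. -/
theorem Admissible.mul_ballProfile_lt {R₁ : ℝ} (h1 : 0.6436044631 < R₁) (h2 : R₁ < 0.6436044633)
    (htouch : touchEq R₁ = 1) {τ : ℝ} (hτ : 0 < τ) {K : Space} {R : ℝ} (hlt : R₁ < R)
    (h : Admissible τ K R) : R * ballProfile R < τ * ballProfile R₁ := by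
  have hR : 0 < R := by linarith
  have hR₁ : 0 < R₁ := by linarith
  have hπ := pi_gt_three
  have hπ' := pi_lt_d6
  have hR4 := h.le_pi_div_four hR
  obtain ⟨hs1, hs2⟩ := sqrt_three_bounds
  have hs3 : √3 ^ 2 = 3 := sq_sqrt (by norm_num)
  have hI := ballProfile_pos hR₁ (by linarith)
  have hprof := ballProfile_mul_sq_le hR₁.le hlt.le (by linarith : R ≤ π)
  have hz := h.coord_two_sq_le hR
  have hn := arcsin_nonneg.2 (abs_nonneg ((K.1 : E3) 2))
  have hτ2 := h.le_two
  set α := arcsin |(K.1 : E3) 2| with hα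
  -- `z² ≤ cos 2R ≤ cos 2R₁ = 1 - 2 sin² R₁`, which is `sin² (√3/2 R₁)` by the touching equation.
  have hα1 : α ≤ √3 / 2 * R₁ := by
    apply arcsin_abs_le (hz.trans _) (by positivity) (by nlinarith)
    have hcos := cos_le_cos_of_nonneg_of_le_pi (x := 2 * R₁) (y := 2 * R) (by linarith)
      (by linarith) (by linarith)
    rw [touchEq] at htouch
    rw [cos_two_mul R₁, cos_sq'] at hcos
    linarith
  have hα1' : 4 * α ^ 2 ≤ 3 * R₁ ^ 2 := by
    have := pow_le_pow_left₀ hn hα1 2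
    rw [mul_pow, div_pow, hs3] at this
    linarith
  have hR₁sq1 : 0.414 < R₁ ^ 2 := by nlinarith
  -- This is the square of `R³ < τ R₁²`; the glide inequality bounds `τ²` below.
  have hcube : (R ^ 2) ^ 3 < τ ^ 2 * (R₁ ^ 2) ^ 2 := by
    have hlt2 : R₁ ^ 2 < R ^ 2 := by gcongr
    have hRub : R ^ 2 < 0.6169 := by nlinarith
    rcases le_or_gt (R ^ 2) (1.3 * R₁ ^ 2) with hc | hc
    · have hτ3 : 4 * R ^ 2 - 3 * R₁ ^ 2 ≤ τ ^ 2 := by linarith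
      have hpos : 0 < (R₁ ^ 2) ^ 2 := by positivity
      refine lt_of_lt_of_le ?_ (mul_le_mul_of_nonneg_right hτ3 hpos.le)
      exact cube_lt_of_le_mul (by positivity) hlt2 hc
    -- `0.73²` is below `1.3 · 0.414`, and `0.37` is chosen so that `cos 1.46 ≤ sin² 0.37`.
    · have hRlb : 0.73 < R := by
        by_contra! hle
        nlinarith
      have hcos : cos (2 * R) ≤ sin 0.37 ^ 2 := by
        have e1 := cos_le_cos_of_nonneg_of_le_pi (x := 2 * 0.73) (y := 2 * R) (by norm_num)
          (by linarith) (by linarith)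
        have e2 := cos_le_cosTaylor (n := 3) (by decide) (x := 2 * 0.73) (by norm_num)
        norm_num [cosTaylor, Finset.sum_range_succ, Nat.factorial] at e1 e2
        have e3 : 0.357 < sin 0.37 := lt_of_le_of_lt (by norm_num)
          (sin_gt_sub_cube (x := 0.37) (by norm_num))
        have e4 := pow_le_pow_left₀ (by norm_num) e3.le 2
        norm_num at e4 ⊢
        linarith
      have hα2 : α ≤ 0.37 := arcsin_abs_le (hz.trans hcos) (by norm_num) (by linarith)
      have hα3 : 4 * α ^ 2 ≤ 0.5476 := by
        have := pow_le_pow_left₀ hn hα2 2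
        norm_num at this ⊢
        linarith
      have hτ3 : 4 * R ^ 2 - 0.5476 ≤ τ ^ 2 := by linarith
      have hRlb2 : 0.5329 < R ^ 2 := lt_of_eq_of_lt (by norm_num) (pow_lt_pow_left₀ hRlb (by norm_num) two_ne_zero)
      have h4 : 0.171 < (R₁ ^ 2) ^ 2 := lt_of_le_of_lt (by norm_num)
        (pow_lt_pow_left₀ hR₁sq1 (by norm_num) two_ne_zero)
      have h6 : (4 * R ^ 2 - 0.5476) * 0.171 ≤ τ ^ 2 * (R₁ ^ 2) ^ 2 := by gcongr
      refine lt_of_lt_of_le ?_ h6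
      exact cube_lt_of_mem_Ioo hRlb2 hRub
  have hcube' : R ^ 3 < τ * R₁ ^ 2 := by
    apply lt_of_pow_lt_pow_left₀ 2 (by positivity)
    linarith [(by ring : (R ^ 3) ^ 2 = (R ^ 2) ^ 3),
      (by ring : (τ * R₁ ^ 2) ^ 2 = τ ^ 2 * (R₁ ^ 2) ^ 2)]
  have hsq : 0 < R₁ ^ 2 := by positivity
  apply lt_of_mul_lt_mul_right _ hsq.le
  calc R * ballProfile R * R₁ ^ 2 = R * (ballProfile R * R₁ ^ 2) := by ring
    _ ≤ R * (ballProfile R₁ * R ^ 2) := by gcongr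
    _ = R ^ 3 * ballProfile R₁ := by ring
    _ < τ * R₁ ^ 2 * ballProfile R₁ := by gcongr
    _ = τ * ballProfile R₁ * R₁ ^ 2 := by ring

/-- Equality in the density bound determines the arrangement. -/
theorem Admissible.density_le {R₁ : ℝ} (h1 : 0.6436044631 < R₁) (h2 : R₁ < 0.6436044633)
    (htouch : touchEq R₁ = 1) {τ : ℝ} (hτ : 0 < τ) {K : Space} {R : ℝ} (hR : 0 < R)
    (h : Admissible τ K R) : 2 * R * ballProfile R / τ ≤ 2 * ballProfile R₁ ∧
      (2 * R * ballProfile R / τ = 2 * ballProfile R₁ → τ = R₁ ∧ R = R₁) := by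
  have hπ := pi_gt_three
  have hR4 := h.le_pi_div_four hR
  have hI := ballProfile_pos hR (by linarith)
  have hI₁ := ballProfile_pos (R := R₁) (by linarith) (by linarith)
  rw [div_le_iff₀ hτ, div_eq_iff hτ.ne']
  rcases lt_trichotomy R R₁ with hlt | rfl | hlt
  · have hmono := ballProfile_strictMonoOn ⟨hR.le, by linarith⟩ ⟨by linarith, by linarith⟩ hlt
    have : R * ballProfile R < τ * ballProfile R₁ := by
      calc R * ballProfile R < R * ballProfile R₁ := by gcongr
        _ ≤ τ * ballProfile R₁ := by gcongr; exact h.le_translation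
    exact ⟨by linarith, fun he => by linarith⟩
  · have := mul_le_mul_of_nonneg_right h.le_translation hI.le
    refine ⟨by linarith, fun he => ⟨?_, rfl⟩⟩
    apply mul_right_cancel₀ hI.ne'
    linarith
  · have := h.mul_ballProfile_lt h1 h2 htouch hτ hlt
    exact ⟨by linarith, fun he => by linarith⟩

/-- With `τ = R` the coordinates satisfy `|x|, |y| ≥ sin R` and `|z| ≥ sin (√3/2 R)`. The squares of
these bounds already sum to `1` by the touching equation, so none is strict. -/
theorem Admissible.abs_coord_eq {R : ℝ} (h1 : 0.6436044631 < R) (h2 : R < 0.6436044633)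
    (htouch : touchEq R = 1) {K : Space} (h : Admissible R K R) (i : Fin 3) :
    |(K.1 : E3) i| = |(geoPoint (π / 4) (√3 / 2 * R) : E3) i| := by
  obtain ⟨hc0, hc1, hc2⟩ := geoPoint_coords h1 h2 htouch
  obtain ⟨hs1, hs2⟩ := sqrt_three_bounds
  have hs3 : √3 ^ 2 = 3 := sq_sqrt (by norm_num)
  have hπ := pi_gt_three
  have hR : 0 < R := by linarith
  obtain ⟨h0, h1'⟩ := h.sin_le_abs_coord hR
  have hs : 0 ≤ sin R := sin_nonneg_of_nonneg_of_le_pi hR.le (by linarith)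
  have ht : 0 ≤ sin (√3 / 2 * R) := sin_nonneg_of_nonneg_of_le_pi (by positivity) (by nlinarith)
  have hα : √3 / 2 * R ≤ arcsin |(K.1 : E3) 2| := by
    apply le_of_sq_le_sq _ (arcsin_nonneg.2 (abs_nonneg _))
    rw [mul_pow, div_pow, hs3]
    linarith [h.le_two]
  have h2' : sin (√3 / 2 * R) ≤ |(K.1 : E3) 2| := by
    rwa [← le_arcsin_iff_sin_le ⟨by nlinarith, by nlinarith⟩
      ⟨by linarith [abs_nonneg ((K.1 : E3) 2)], abs_coord_le_one _ _⟩]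
  have q0 := pow_le_pow_left₀ hs h0 2
  have q1 := pow_le_pow_left₀ hs h1' 2
  have q2 := pow_le_pow_left₀ ht h2' 2
  rw [sq_abs] at q0 q1 q2
  have hsum := sum_sq_coords K.1
  rw [touchEq] at htouch
  rw [← sq_eq_sq_iff_abs_eq_abs]
  fin_cases i
  · show (K.1 : E3) 0 ^ 2 = (geoPoint (π / 4) (√3 / 2 * R) : E3) 0 ^ 2
    rw [hc0]; linarith
  · show (K.1 : E3) 1 ^ 2 = (geoPoint (π / 4) (√3 / 2 * R) : E3) 1 ^ 2
    rw [hc1]; linarith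
  · show (K.1 : E3) 2 ^ 2 = (geoPoint (π / 4) (√3 / 2 * R) : E3) 2 ^ 2
    rw [hc2]; linarith

end S2R

end

/-! ### The theorem -/

theorem theorem2p7 :
    ∃ θ₁ R₁ τ₁ : ℝ, ∃ K₁ : Space,
      K₁ = (geoPoint (π / 4) θ₁, 0) ∧ K₁.1 ∈ triangleInterior ∧ 0 < τ₁ ∧
      -- the arrangement `B_Γ(R₁, K₁)` exists and is determined by its requirements
      (∀ (τ R : ℝ) (P : Sphere2), 0 < τ → P ∈ triangleInterior →
        (IsFirstArrangement τ (P, 0) R ↔ τ = τ₁ ∧ R = R₁ ∧ ((P, 0) : Space) = K₁)) ∧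
      -- it is a simply transitive ball packing, with the greatest possible radius for its kernel
      IsSimplyTransitive (spaceGroup τ₁) K₁ ∧
      IsGreatest {R : ℝ | IsBallPacking (spaceGroup τ₁) K₁ R} R₁ ∧
      -- its numerical data
      |θ₁ - 0.55737781| < 1 / 10 ^ 8 ∧
      |R₁ - 0.64360446| < 1 / 10 ^ 8 ∧
      |vol.real (gball K₁ R₁) - 1.08624788| < 1 / 10 ^ 8 ∧
      |density (spaceGroup τ₁) K₁ R₁ - 0.53722971| < 1 / 10 ^ 8 ∧
      -- it is the densest one, and the only densest one up to symmetries of the point group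
      -- and translations along the fibres
      (∀ (τ R : ℝ) (K : Space), 0 < τ → IsSimplyTransitive (spaceGroup τ) K →
        IsBallPacking (spaceGroup τ) K R →
          density (spaceGroup τ) K R ≤ density (spaceGroup τ₁) K₁ R₁ ∧
          (density (spaceGroup τ) K R = density (spaceGroup τ₁) K₁ R₁ ↔
            τ = τ₁ ∧ R = R₁ ∧ ∀ i : Fin 3, |(K.1 : E3) i| = |(K₁.1 : E3) i|)) := by
  obtain ⟨R₁, h1, h2, h⟩ := exists_touchEq_eq_one
  obtain ⟨hc0, hc1, hc2⟩ := geoPoint_coords h1 h2 h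
  obtain ⟨hs1, hs2⟩ := sqrt_three_bounds
  have hπ := pi_gt_d20
  have hπ' := pi_lt_d20
  have hR₁ : 0 < R₁ := by linarith
  have hadm := admissible_optimal h1 h2 h
  have hsin : 0 < sin R₁ := sin_pos_of_pos_of_lt_pi hR₁ (by linarith)
  have hsinθ : 0 < sin (√3 / 2 * R₁) := sin_pos_of_pos_of_lt_pi (by positivity) (by nlinarith)
  obtain ⟨hI, hI'⟩ := ballProfile_bounds h1 h2
  have hdens : density (spaceGroup R₁) (geoPoint (π / 4) (√3 / 2 * R₁), 0) R₁ =
      2 * ballProfile R₁ := by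
    rw [density_eq hR₁ (by rw [hc0]; exact hsin.ne') (by rw [hc1]; exact hsin.ne') hR₁ hadm]
    field_simp
  refine ⟨√3 / 2 * R₁, R₁, R₁, (geoPoint (π / 4) (√3 / 2 * R₁), 0), rfl, ?_, hR₁, ?_, ?_, ?_, ?_,
    ?_, ?_, ?_, ?_⟩
  · intro i
    fin_cases i
    · exact hc0.symm ▸ hsin
    · exact hc1.symm ▸ hsin
    · exact hc2.symm ▸ hsinθ
  · intro τ R P hτ hP
    rw [isFirstArrangement_iff h1 h2 h hτ hP, Prod.mk.injEq]
    simp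
  · exact isSimplyTransitive_of_coords_ne_zero hR₁ (by rw [hc0]; exact hsin.ne')
      (by rw [hc1]; exact hsin.ne')
  · refine ⟨hadm.isBallPacking hR₁, fun R hR => ?_⟩
    -- Since the glide length equals `R₁`, the bound `R ≤ τ` alone makes the radius greatest.
    exact (admissible_of_isBallPacking hR₁ (by rw [hc0]; exact hsin.ne')
      (by rw [hc1]; exact hsin.ne') hR).le_translation
  · rw [abs_lt]
    constructor <;> norm_num <;> nlinarith
  · rw [abs_lt]
    constructor <;> norm_num <;> linarith
  · have hI0 : 0 < ballProfile R₁ := by linarith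
    rw [measureReal_def, vol_gball _ hR₁ (by linarith), ENNReal.toReal_ofReal (by positivity)]
    have hlo : 2 * 3.14159265358 * 0.6436044631 * 0.268614853 < 2 * π * R₁ * ballProfile R₁ := by
      gcongr
      linarith
    have hhi : 2 * π * R₁ * ballProfile R₁ < 2 * 3.14159265359 * 0.6436044633 * 0.268614855 := by
      gcongr
      linarith
    rw [abs_lt]
    constructor <;> norm_num at hlo hhi ⊢ <;> linarith
  · rw [hdens, abs_lt]
    constructor <;> norm_num <;> linarith
  · intro τ R K hτ hK hpack
    obtain ⟨k0, k1⟩ := coords_ne_zero hK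
    have hR := hpack.1
    have ha := admissible_of_isBallPacking hτ k0 k1 hpack
    rw [hdens, density_eq hτ k0 k1 hR ha]
    obtain ⟨hle, heq⟩ := ha.density_le h1 h2 h hτ hR
    refine ⟨hle, fun he => ?_, ?_⟩
    · obtain ⟨hτR, hRR⟩ := heq he
      rw [hτR, hRR] at ha
      exact ⟨hτR, hRR, ha.abs_coord_eq h1 h2 h⟩
    -- The density depends on `τ` and `R` only, so the condition on coordinates is not needed in
    -- this direction.
    · rintro ⟨rfl, rfl, -⟩
      field_simp
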